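/- **Setting.** Let $r$ and $n=q_1r+r_1$ be positive integers with $q_1\ge 1$ and $0<r_1<r$. Let $\mathcal A$ be the algebra of germs at the origin of holomorphic functions on $\mathbb C^n\times\mathbb C^r$, with coordinates $a_0,\dots,a_{n-1},b_0,\dots,b_{r-1}$, and put $m=n+r$. For an ideal $J\subseteq\mathcal A$ let $\Delta_kJ$ be the ideal generated by $J$ and all $k\times k$ minors of Jacobian matrices (with respect to the $m$ coordinates) of elements of $J$ (the minor of order $0$ is $1$), and let $\Delta^iJ=\Delta_{m-i+1}J$. The ideal $\Delta^iJ$ is called the critical extension of $J$ if $\Delta_{m-i+1}J\ne\mathcal A$ and $\Delta_{m-i}J=\mathcal A$. Let $I(\mu_{n,r})\subseteq\mathcal A$ be the ideal generated by the coefficients $c_0,\dots,c_{n+r-1}$ of $$(x^n+a_{n-1}x^{n-1}+\dots+a_0)(x^r+b_{r-1}x^{r-1}+\dots+b_0)=x^{n+r}+c_{n+r-1}x^{n+r-1}+\dots+c_0 .$$ Define polynomials $d_{n-1},\dots,d_0$ by $d_{n-j}=a_{n-j}-b_{r-j}-\sum_{i+k=j,\ i,k\ge1}d_{n-i}b_{r-k}$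 for $1\le j\le n$, where $b_l$ is read as $0$ for $l<0$. Let $L_n$ be the $n\times n$ lower shift matrix (ones on the subdiagonal, zeros elsewhere), and let $$B=I_n+b_{r-1}L_n+\dots+b_0L_n^r,\qquad \widehat D=I_n+d_{n-1}L_n+\dots+d_1L_n^{n-1}.$$ For $1\le k<n$ let $\beta_k$ be the entry of $(B^{-q_1}\widehat D)^{-1}$ in row $n-k+1$ of its first column. Define - $\psi_i=d_i$ for $0\le i<r$; - $\psi_{sr+i}=\dfrac{\partial^s d_{r-1}}{\partial b_0^{\,s-1}\,\partial b_{r-1-i}}$ for $1\le s\le q_1-1$ and $0\le i<r$; - $\psi_{q_1r+i}=\beta_{(q_1-1)r+r_1+i}$ for $0\le i<r_1$. **Theorem 3.10.** The first $q_1+1$ successive critical extensions of $I(\mu_{n,r})$ are obtained by applying $\Delta^r$ $q_1$ times and then $\Delta^{r_1}$: for $0\le s<q_1$ the ideal $\Delta^r\big((\Delta^r)^sI(\mu_{n,r})\big)$ is the critical extension of $(\Delta^r)^sI(\mu_{n,r})$, and $\Delta^{r_1}\big((\Delta^r)^{q_1}I(\mu_{n,r})\big)$ is the critical extension of $(\Delta^r)^{q_1}I(\mu_{n,r})$.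 Moreover $$(B^{-q_1}\widehat D)^{-1}=I_n+\beta_{n-1}L_n+\dots+\beta_1L_n^{n-1},$$ and the $(q_1+1)$-th critical extension is $$\Delta^{r_1}\big((\Delta^r)^{q_1}I(\mu_{n,r})\big)=I(\mu_{n,r})+(\psi_0,\dots,\psi_{q_1r-1},\psi_{q_1r},\dots,\psi_{q_1r+r_1-1}).$$ -/

import Mathlib

open Filter Topology

noncomputable section

/-! ### Germs of holomorphic functions and Jacobian extensions -/

/-- The algebra of germs at the origin of holomorphic functions on `ℂ^σ`, as a subring of the
ring of all germs at `0` of functions `ℂ^σ → ℂ`. -/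
def HolGerm (σ : Type) [Fintype σ] : Subring (Germ (𝓝 (0 : σ → ℂ)) ℂ) where
  carrier := {φ | ∃ f : (σ → ℂ) → ℂ, AnalyticAt ℂ f 0 ∧ (f : Germ (𝓝 (0 : σ → ℂ)) ℂ) = φ}
  mul_mem' := by
    rintro _ _ ⟨f, hf, rfl⟩ ⟨g, hg, rfl⟩
    exact ⟨f * g, hf.mul hg, rfl⟩
  one_mem' := ⟨fun _ => 1, analyticAt_const, rfl⟩
  add_mem' := by
    rintro _ _ ⟨f, hf, rfl⟩ ⟨g, hg, rfl⟩
    exact ⟨f + g, hf.add hg, rfl⟩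
  zero_mem' := ⟨fun _ => 0, analyticAt_const, rfl⟩
  neg_mem' := by
    rintro _ ⟨f, hf, rfl⟩
    exact ⟨-f, hf.neg, rfl⟩

/-- The partial derivative `∂φ/∂x_j` of a holomorphic germ `φ`. -/
def HolGerm.partialDeriv {σ : Type} [Fintype σ] [DecidableEq σ] (j : σ) (φ : HolGerm σ) :
    HolGerm σ :=
  ⟨Germ.map' (fun f x => fderiv ℂ f x (Pi.single j 1))
      (fun _ _ h => (h.fderiv (𝕜 := ℂ)).mono fun x hx => by simp only [hx]) φ.1, by
    obtain ⟨_, f, hf, rfl⟩ := φ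
    exact ⟨fun x => fderiv ℂ f x (Pi.single j 1),
      (ContinuousLinearMap.apply ℂ ℂ (Pi.single j 1 : σ → ℂ)).analyticAt _ |>.comp hf.fderiv,
      rfl⟩⟩

/-- The germ at the origin of a polynomial function. -/
def polyGerm {σ : Type} [Fintype σ] (p : MvPolynomial σ ℂ) : HolGerm σ :=
  ⟨((fun x : σ → ℂ => MvPolynomial.eval x p : (σ → ℂ) → ℂ) : Germ (𝓝 (0 : σ → ℂ)) ℂ),
    _, AnalyticOnNhd.eval_mvPolynomial p 0 (Set.mem_univ 0), rfl⟩

/-- The Jacobian extension `Δ_k J`: the ideal spanned by `J` and all minors of order `k` of the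
Jacobian matrix `(∂f_i/∂x_j)` formed from the partial derivatives of the functions `f ∈ J`.
(A choice of rows or columns with repetition contributes only the determinant `0`.) -/
def jacobianExt {σ : Type} [Fintype σ] [DecidableEq σ] (k : ℕ) (J : Ideal (HolGerm σ)) :
    Ideal (HolGerm σ) :=
  J ⊔ Ideal.span {φ | ∃ (f : Fin k → HolGerm σ) (c : Fin k → σ), (∀ i, f i ∈ J) ∧
    φ = Matrix.det (Matrix.of fun i j => HolGerm.partialDeriv (c j) (f i))}

/-- Upper indexing: `Δ^i J = Δ_{m-i+1} J`, where `m` is the number of variables. -/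
def upperJacobianExt {σ : Type} [Fintype σ] [DecidableEq σ] (i : ℕ) (J : Ideal (HolGerm σ)) :
    Ideal (HolGerm σ) :=
  jacobianExt (Fintype.card σ + 1 - i) J

/-- `Δ^i J` is a critical extension of `J`: with `k = m - i + 1` (and `0 ≤ i ≤ m`) one has
`Δ_k J ≠ 𝒜` and `Δ_{k-1} J = 𝒜`. -/
def IsCriticalUpper {σ : Type} [Fintype σ] [DecidableEq σ] (i : ℕ) (J : Ideal (HolGerm σ)) :
    Prop :=
  i ≤ Fintype.card σ ∧ jacobianExt (Fintype.card σ + 1 - i) J ≠ ⊤ ∧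
    jacobianExt (Fintype.card σ - i) J = ⊤

/-! ### The polynomial multiplication map -/

/-- The coordinate ring of `ℂ^n × ℂ^r`, with coordinates `a_0, …, a_{n-1}` (left summand) and
`b_0, …, b_{r-1}` (right summand). -/
abbrev CoeffRing (n r : ℕ) : Type := MvPolynomial (Fin n ⊕ Fin r) ℂ

/-- The coordinate `a_i`, for `i < n`. -/
def aVar (n r i : ℕ) : CoeffRing n r :=
  if h : i < n then MvPolynomial.X (Sum.inl ⟨i, h⟩) else 0

/-- The coordinate `b_j`, for `j < r`. -/
def bVar (n r j : ℕ) : CoeffRing n r :=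
  if h : j < r then MvPolynomial.X (Sum.inr ⟨j, h⟩) else 0

/-- `f(x) = x^n + a_{n-1} x^{n-1} + ⋯ + a_0`. -/
def genericF (n r : ℕ) : Polynomial (CoeffRing n r) :=
  Polynomial.X ^ n + ∑ i ∈ Finset.range n, Polynomial.C (aVar n r i) * Polynomial.X ^ i

/-- `g(x) = x^r + b_{r-1} x^{r-1} + ⋯ + b_0`. -/
def genericG (n r : ℕ) : Polynomial (CoeffRing n r) :=
  Polynomial.X ^ r + ∑ j ∈ Finset.range r, Polynomial.C (bVar n r j) * Polynomial.X ^ j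

/-- `c_j`, the coefficient of `x^j` in `h(x) = f(x) g(x)`. -/
def cPoly (n r j : ℕ) : CoeffRing n r := (genericF n r * genericG n r).coeff j

/-- The ideal `I(μ_{n,r})` of germs generated by `c_0, …, c_{n+r-1}`. -/
def muIdeal (n r : ℕ) : Ideal (HolGerm (Fin n ⊕ Fin r)) :=
  Ideal.span {φ | ∃ j, j < n + r ∧ φ = polyGerm (cPoly n r j)}

/-! ### Toeplitz matrices -/

/-- The lower shift matrix `L_N`. -/
def lowerShift (R : Type) [CommRing R] (N : ℕ) : Matrix (Fin N) (Fin N) R :=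
  Matrix.of fun i j => if (i : ℕ) = j + 1 then 1 else 0

/-- The lower Toeplitz matrix `I_N + v_{m-1} L_N + v_{m-2} L_N^2 + ⋯ + v_0 L_N^m`. -/
def lowerToeplitz {R : Type} [CommRing R] (N m : ℕ) (v : ℕ → R) : Matrix (Fin N) (Fin N) R :=
  1 + ∑ k ∈ Finset.Icc 1 m, v (m - k) • lowerShift R N ^ k

/-- The coefficient of `L_N^k` in a lower Toeplitz matrix: its entry in row `k` of the first
column (counting from `0`). -/
def toeplitzCoeff {R : Type} [CommRing R] {N : ℕ} (M : Matrix (Fin N) (Fin N) R) (k : ℕ) : R :=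
  if h : k < N then M ⟨k, h⟩ ⟨0, by omega⟩ else 0

/-! ### The polynomials `d`, `β` and `ψ` -/

/-- `dTop n r j` is `d_{n-j}`, for `1 ≤ j ≤ n`, given by the recursion
`d_{n-j} = a_{n-j} - b_{r-j} - ∑_{i+k=j} d_{n-i} b_{r-k}` (`i, k ≥ 1`), where `b_{r-k}` is
omitted if `k > r`. -/
def dTop (n r j : ℕ) : CoeffRing n r :=
  aVar n r (n - j) - (if j ≤ r then bVar n r (r - j) else 0)
    - ∑ i ∈ (Finset.Ioo 0 j).attach,
        dTop n r i.1 * (if j - i.1 ≤ r then bVar n r (r - (j - i.1)) else 0)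
termination_by j
decreasing_by exact (Finset.mem_Ioo.mp i.2).2

/-- `d_k`, for `0 ≤ k < n`. -/
def dPoly (n r k : ℕ) : CoeffRing n r := dTop n r (n - k)

/-- `B = I_n + b_{r-1} L_n + ⋯ + b_0 L_n^r`. -/
def matB (n r : ℕ) : Matrix (Fin n) (Fin n) (CoeffRing n r) := lowerToeplitz n r (bVar n r)

/-- `D̂ = I_n + d_{n-1} L_n + ⋯ + d_1 L_n^{n-1}` (the summand with `L_n^n = 0` is harmless). -/
def matDhat (n r : ℕ) : Matrix (Fin n) (Fin n) (CoeffRing n r) := lowerToeplitz n n (dPoly n r)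

/-- The Toeplitz matrix `B^{-q} D̂`. -/
def matBD (n r q : ℕ) : Matrix (Fin n) (Fin n) (CoeffRing n r) := (matB n r)⁻¹ ^ q * matDhat n r

/-- `β_k`, for `1 ≤ k < n`: the coefficient of `L_n^{n-k}` in `(B^{-q} D̂)⁻¹`. -/
def betaPoly (n r q k : ℕ) : CoeffRing n r := toeplitzCoeff (matBD n r q)⁻¹ (n - k)

/-- The partial derivative `∂p/∂b_j`, for `j < r`. -/
def derivB (n r j : ℕ) (p : CoeffRing n r) : CoeffRing n r :=
  if h : j < r then MvPolynomial.pderiv (Sum.inr ⟨j, h⟩) p else 0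

/-- The polynomials `ψ_k`, where `n = q r + r₁`:
* `ψ_i = d_i` for `0 ≤ i < r`;
* `ψ_{sr+i} = ∂^s d_{r-1} / ∂b_0^{s-1} ∂b_{r-1-i}` for `1 ≤ s ≤ q - 1`, `0 ≤ i < r`;
* `ψ_{qr+i} = β_{(q-1)r+r₁+i}` for `0 ≤ i < r₁`. -/
def psiPoly (n r q r₁ k : ℕ) : CoeffRing n r :=
  if k < r then dPoly n r k
  else if k < q * r then
    (derivB n r 0)^[k / r - 1] (derivB n r (r - 1 - k % r) (dPoly n r (r - 1)))
  else betaPoly n r q ((q - 1) * r + r₁ + (k - q * r))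

/-- A lower Toeplitz matrix with unit diagonal is invertible, so that the matrix inverses above
are genuine ones. -/
theorem isUnit_det_lowerToeplitz {R : Type} [CommRing R] (N m : ℕ) (v : ℕ → R) :
    IsUnit (lowerToeplitz N m v).det := by
  have hL : ∀ k : ℕ, ∀ i j : Fin N, (i : ℕ) < j + k → (lowerShift R N ^ k) i j = 0 := by
    intro k
    induction k with
    | zero =>
      intro i j h
      rw [pow_zero, Matrix.one_apply_ne]
      rintro rfl
      omega
    | succ k ih =>
      intro i j h
      rw [pow_succ, Matrix.mul_apply]
      refine Finset.sum_eq_zero fun l _ => ?_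
      by_cases hl : (l : ℕ) = j + 1
      · rw [ih i l (by omega), zero_mul]
      · simp [lowerShift, hl]
  have hS : ∀ i j : Fin N, (i : ℕ) ≤ j →
      (∑ k ∈ Finset.Icc 1 m, v (m - k) • lowerShift R N ^ k) i j = 0 := by
    intro i j h
    rw [Matrix.sum_apply]
    refine Finset.sum_eq_zero fun k hk => ?_
    have := (Finset.mem_Icc.mp hk).1
    rw [Matrix.smul_apply, hL k i j (by omega), smul_zero]
  rw [Matrix.det_of_isLowerTriangular]
  · have : ∀ i : Fin N, lowerToeplitz N m v i i = 1 := fun i => by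
      rw [lowerToeplitz, Matrix.add_apply, hS i i le_rfl, Matrix.one_apply_eq, add_zero]
    simp [this]
  · intro i j hij
    have hij' : i < j := hij
    rw [lowerToeplitz, Matrix.add_apply, hS i j (le_of_lt hij'),
      Matrix.one_apply_ne hij'.ne, add_zero]

end

/-!
Reversed, the two generic polynomials become power series `F` and `G` with constant term `1`, and
the coefficients of `K = F * G` generate `I(μ)`. At every stage `K = U ^ a * H ^ b` where, modulo
the elements `x_0, …, x_{m-1}` adjoined so far, `U` and `H` are polynomials of degrees `N` and `M`
whose coefficients, together with the `x_k`, have gradients forming a basis. Up to a unit series,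
`grad K` is `a • grad U + b • (U / H) • grad H`. Hence the minors of order `m + N` of the Jacobian
matrix generate the unit ideal, and those of order `m + N + 1` generate, modulo the ideal, the
coefficients of `U / H` of index `N - M + 1, …, N`. Adjoining these makes `U / H` a polynomial of
degree `N - M`, and the next stage is the pair `(U / H, H)`. Dividing `F` by `G` successively, and
in the last stage exchanging the roles of the two series, gives the critical extensions; the `ψ_k`
are the adjoined coefficients up to units.
-/

noncomputable section

open PowerSeries

section minorIdeal
variable {S V ι κ : Type*} [CommRing S] [AddCommGroup V] [Module S V]

/-- The `k`-th determinantal ideal of a submodule `Ω`: it is generated by the determinants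
`det (ℓ_j(ω_i))` with `ω_1, …, ω_k ∈ Ω` and `ℓ_1, …, ℓ_k` linear forms. Allowing all linear forms,
and not only the coordinate ones, makes it visibly independent of a basis of the ambient module. -/
def minorIdeal (k : ℕ) (Ω : Submodule S V) : Ideal S :=
  Ideal.span {x | ∃ (ω : Fin k → V) (ℓ : Fin k → Module.Dual S V), (∀ i, ω i ∈ Ω) ∧
    x = (Matrix.of fun i j => ℓ j (ω i)).det}

theorem det_mem_minorIdeal [Fintype ι] [DecidableEq ι] {Ω : Submodule S V} {ω : ι → V}
    (hω : ∀ i, ω i ∈ Ω) (ℓ : ι → Module.Dual S V) :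
    (Matrix.of fun i j => ℓ j (ω i)).det ∈ minorIdeal (Fintype.card ι) Ω := by
  let e := (Fintype.equivFin ι).symm
  refine Ideal.subset_span ⟨ω ∘ e, ℓ ∘ e, fun i => hω _, ?_⟩
  rw [← Matrix.det_submatrix_equiv_self e]
  rfl

theorem minorIdeal_eq_span_coord [Finite ι] (b : Module.Basis ι S V) (k : ℕ)
    (Ω : Submodule S V) :
    minorIdeal k Ω = Ideal.span {x | ∃ (ω : Fin k → V) (c : Fin k → ι), (∀ i, ω i ∈ Ω) ∧
      x = (Matrix.of fun i j => b.coord (c j) (ω i)).det} := by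
  have := Fintype.ofFinite ι
  apply le_antisymm <;> rw [minorIdeal, Ideal.span_le]
  · rintro _ ⟨ω, ℓ, hω, rfl⟩
    have expand : (Matrix.of fun i j => ℓ j (ω i)).transpose.det =
        Matrix.detRowAlternating.toMultilinearMap
          (fun j => ∑ l, ℓ j (b l) • fun i => b.coord l (ω i)) := by
      refine congrArg Matrix.det (Matrix.ext fun j i => ?_)
      simpa [-Module.Basis.sum_dual_apply_smul_coord] using
        (LinearMap.congr_fun (b.sum_dual_apply_smul_coord (ℓ j)) (ω i)).symm
    rw [SetLike.mem_coe, ← Matrix.det_transpose, expand, MultilinearMap.map_sum]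
    refine Ideal.sum_mem _ fun c _ => ?_
    rw [MultilinearMap.map_smul_univ]
    refine Ideal.mul_mem_left _ _ (Ideal.subset_span ⟨ω, c, hω, ?_⟩)
    rw [← Matrix.det_transpose]
    rfl
  · rintro _ ⟨ω, c, hω, rfl⟩
    exact Ideal.subset_span ⟨ω, fun j => b.coord (c j), hω, rfl⟩

theorem minorIdeal_card_eq_top [Fintype ι] (b : Module.Basis (ι ⊕ κ) S V) {Ω : Submodule S V}
    (hΩ : ∀ i, b (.inl i) ∈ Ω) : minorIdeal (Fintype.card ι) Ω = ⊤ := by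
  classical
  rw [Ideal.eq_top_iff_one]
  convert det_mem_minorIdeal hΩ fun j => b.coord (.inl j)
  rw [← Matrix.det_one (n := ι)]
  congr 1
  ext i j
  simp [Matrix.one_apply, Finsupp.single_apply]

theorem det_mem_of_column_mem [Fintype ι] [DecidableEq ι] {I : Ideal S}
    {A : Matrix ι ι S} (j : ι) (h : ∀ i, A i j ∈ I) : A.det ∈ I := by
  rw [← Ideal.Quotient.eq_zero_iff_mem, RingHom.map_det]
  exact Matrix.det_eq_zero_of_column_eq_zero j fun i => Ideal.Quotient.eq_zero_iff_mem.mpr (h i)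

theorem minorIdeal_card_succ_eq_span [Fintype ι] [Finite κ] (b : Module.Basis (ι ⊕ κ) S V)
    {T : Set V} (hT : ∀ i, b (.inl i) ∈ Submodule.span S T) :
    minorIdeal (Fintype.card ι + 1) (Submodule.span S T) =
      Ideal.span {x | ∃ ω ∈ T, ∃ j, x = b.coord (.inr j) ω} := by
  classical
  set I := Ideal.span {x | ∃ ω ∈ T, ∃ j, x = b.coord (.inr j) ω}
  have coord_inr_mem : ∀ ω ∈ Submodule.span S T, ∀ j, b.coord (.inr j) ω ∈ I := by
    intro ω hω j
    have : Submodule.span S T ≤ Submodule.comap (b.coord (.inr j)) I :=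
      Submodule.span_le.mpr fun ω hω => Ideal.subset_span ⟨ω, hω, j, rfl⟩
    exact this hω
  refine le_antisymm ?_ (Ideal.span_le.mpr ?_)
  · rw [minorIdeal_eq_span_coord b, Ideal.span_le]
    rintro _ ⟨ω, c, hω, rfl⟩
    by_cases hc : ∃ j k, c j = .inr k
    · obtain ⟨j, k, hjk⟩ := hc
      refine det_mem_of_column_mem j fun i => ?_
      rw [Matrix.of_apply, hjk]
      exact coord_inr_mem _ (hω i) k
    · have : ∀ j, ∃ i, c j = .inl i := fun j => by
        rcases h : c j with i | k
        exacts [⟨i, rfl⟩, (hc ⟨j, k, h⟩).elim]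
      choose c' hc' using this
      obtain ⟨j, k, hjk, hc'jk⟩ := Fintype.exists_ne_map_eq_of_card_lt c' (by simp)
      rw [Matrix.det_zero_of_column_eq hjk fun i => by simp [hc', hc'jk]]
      exact I.zero_mem
  · rintro _ ⟨ω, hω, j, rfl⟩
    have h := det_mem_minorIdeal (ι := ι ⊕ Unit) (ω := Sum.elim (fun i => b (.inl i)) fun _ => ω)
      (Ω := Submodule.span S T)
      (Sum.rec hT fun _ => Submodule.subset_span hω)
      (Sum.elim (fun i => b.coord (.inl i)) fun _ => b.coord (.inr j))
    have block : (Matrix.of fun i k => (Sum.elim (fun i => b.coord (.inl i))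
        (fun _ : Unit => b.coord (.inr j)) k)
          (Sum.elim (fun i => b (.inl i)) (fun _ : Unit => ω) i)) =
        Matrix.fromBlocks (1 : Matrix ι ι S) 0 (Matrix.of fun _ i => b.coord (.inl i) ω)
          (Matrix.of fun _ _ => b.coord (.inr j) ω) := by
      ext (i | i) (k | k) <;> simp [Matrix.one_apply, Finsupp.single_apply]
    rw [block, Matrix.det_fromBlocks_zero₁₂] at h
    simpa using h

end minorIdeal

section minorExt
variable {R S σ : Type*} [CommRing R] [CommRing S] [Algebra R S]

/-- The ideal generated by `J` and the minors of order `k` of the Jacobian matrices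
`(d_j f_i)` with `f_i ∈ J`, for an arbitrary family `d` of derivations. -/
def minorExt (d : σ → Derivation ℤ R R) (k : ℕ) (J : Ideal R) : Ideal R :=
  J ⊔ Ideal.span {φ | ∃ (f : Fin k → R) (c : Fin k → σ), (∀ i, f i ∈ J) ∧
    φ = Matrix.det (Matrix.of fun i j => d (c j) (f i))}

variable (S) in
/-- The gradient of `f` with respect to the derivations `d`, with its entries mapped to the
`R`-algebra `S`, which is usually a quotient of `R`. -/
def grad (d : σ → Derivation ℤ R R) (f : R) : σ → S := fun j => algebraMap R S (d j f)

variable {d : σ → Derivation ℤ R R} {T : Set R}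

theorem coe_span_grad_image (hπ : Function.Surjective (algebraMap R S))
    (hT : ∀ f ∈ T, algebraMap R S f = 0) :
    (Submodule.span S (grad S d '' T) : Set (σ → S)) = grad S d '' Ideal.span T := by
  have smul_eq : ∀ a, ∀ f ∈ Ideal.span T,
      grad S d (a * f) = algebraMap R S a • grad S d f := by
    intro a f hf
    have hf0 : algebraMap R S f = 0 :=
      (Ideal.span_le (I := RingHom.ker _)).mpr hT hf
    ext j
    simp [grad, hf0]
  have add_eq : ∀ f g, grad S d (f + g) = grad S d f + grad S d g := by
    intro f g
    ext j
    simp [grad]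
  have zero_eq : grad S d 0 = 0 := by
    ext j
    simp [grad]
  refine Set.Subset.antisymm (fun ω hω => ?_) (Set.image_subset_iff.mpr fun f hf => ?_)
  · induction hω using Submodule.span_induction with
    | mem ω hω => exact Set.image_mono Ideal.subset_span hω
    | zero => exact ⟨0, Submodule.zero_mem _, zero_eq⟩
    | add _ _ _ _ hω hω' =>
      obtain ⟨⟨f, hf, rfl⟩, g, hg, rfl⟩ := And.intro hω hω'
      exact ⟨f + g, add_mem hf hg, add_eq f g⟩
    | smul s _ _ hω =>
      obtain ⟨⟨f, hf, rfl⟩, a, rfl⟩ := And.intro hω (hπ s)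
      exact ⟨a * f, Ideal.mul_mem_left _ a hf, smul_eq a f hf⟩
  · induction hf using Submodule.span_induction with
    | mem f hf => exact Submodule.subset_span ⟨f, hf, rfl⟩
    | zero => simp [zero_eq]
    | add f g _ _ hf hg => simpa [add_eq] using add_mem hf hg
    | smul a f hf ih => simpa [smul_eq a f hf] using Submodule.smul_mem _ (algebraMap R S a) ih

theorem minorExt_span_eq_comap [Finite σ] (hπ : Function.Surjective (algebraMap R S))
    (hker : RingHom.ker (algebraMap R S) = Ideal.span T) (k : ℕ) :
    minorExt d k (Ideal.span T) =
      (minorIdeal k (Submodule.span S (grad S d '' T))).comap (algebraMap R S) := by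
  have hT : ∀ f ∈ T, algebraMap R S f = 0 := fun f hf => hker.ge (Ideal.subset_span hf)
  have mem_iff : ∀ ω : σ → S, ω ∈ Submodule.span S (grad S d '' T) ↔
      ω ∈ grad S d '' Ideal.span T := by
    rw [← coe_span_grad_image hπ hT]
    exact fun _ => Iff.rfl
  have map_minors : minorIdeal k (Submodule.span S (grad S d '' T)) =
      (Ideal.span {φ | ∃ (f : Fin k → R) (c : Fin k → σ), (∀ i, f i ∈ Ideal.span T) ∧
        φ = Matrix.det (Matrix.of fun i j => d (c j) (f i))}).map (algebraMap R S) := by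
    rw [minorIdeal_eq_span_coord (Pi.basisFun S σ), Ideal.map_span]
    congr 1
    ext x
    constructor
    · rintro ⟨ω, c, hω, rfl⟩
      choose f hf hfω using fun i => (mem_iff _).mp (hω i)
      refine ⟨_, ⟨f, c, hf, rfl⟩, ?_⟩
      rw [RingHom.map_det]
      congr 1
      ext i j
      simp [← hfω i, grad]
    · rintro ⟨_, ⟨f, c, hf, rfl⟩, rfl⟩
      exact ⟨fun i => grad S d (f i), c, fun i => (mem_iff _).mpr ⟨_, hf i, rfl⟩,
        RingHom.map_det _ _⟩
  rw [map_minors, Ideal.comap_map_of_surjective _ hπ, ← RingHom.ker_eq_comap_bot, hker,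
    sup_comm, minorExt]

end minorExt

section series
variable {R S σ : Type*} [CommRing R] [CommRing S] [Algebra R S]

theorem coeff_mem_of_mul {I : Ideal R} {A H : R⟦X⟧} {N M : ℕ} (hMN : M ≤ N)
    (hH₀ : constantCoeff H = 1) (hH : ∀ l > M, coeff l H ∈ I) (hAH : ∀ l > N, coeff l (A * H) ∈ I)
    (hA : ∀ l, N - M < l → l ≤ N → coeff l A ∈ I) : ∀ l > N - M, coeff l A ∈ I := by
  intro l
  induction l using Nat.strong_induction_on with
  | _ l ih =>
    intro hl
    by_cases hlN : l ≤ N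
    · exact hA l hl hlN
    have recursion : coeff l A = coeff l (A * H) -
        ∑ i ∈ Finset.range l, coeff i A * coeff (l - i) H := by
      rw [coeff_mul, Finset.Nat.sum_antidiagonal_eq_sum_range_succ_mk, Finset.sum_range_succ]
      simp [hH₀]
    rw [recursion]
    refine I.sub_mem (hAH l (by omega)) (I.sum_mem fun i hi => ?_)
    have hi := Finset.mem_range.mp hi
    by_cases hiM : M < l - i
    · exact I.mul_mem_left _ (hH _ hiM)
    · exact I.mul_mem_right _ (ih i hi (by omega))

/-- The `l`-th coefficient of a vector of power series. -/
def vcoeff (l : ℕ) : (σ → S⟦X⟧) →ₗ[S] (σ → S) := (coeff l).compLeft σ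

theorem vcoeff_apply (l : ℕ) (P : σ → S⟦X⟧) (j : σ) : vcoeff l P j = coeff l (P j) := rfl

theorem vcoeff_smul (l : ℕ) (B : S⟦X⟧) (P : σ → S⟦X⟧) : vcoeff l (B • P) =
    ∑ p ∈ Finset.HasAntidiagonal.antidiagonal l, coeff p.1 B • vcoeff p.2 P := by
  ext j
  simp [vcoeff_apply, coeff_mul]

/-- The vectors of power series all of whose coefficients lie in `Ω`. -/
def coeffsIn (Ω : Submodule S (σ → S)) : Submodule S⟦X⟧ (σ → S⟦X⟧) where
  carrier := {P | ∀ l, vcoeff l P ∈ Ω}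
  add_mem' hP hQ l := by
    rw [map_add]
    exact add_mem (hP l) (hQ l)
  zero_mem' l := by simp
  smul_mem' B P hP l := by
    rw [vcoeff_smul]
    exact sum_mem fun p _ => Ω.smul_mem _ (hP p.2)

variable (S) in
/-- The gradient of a power series, taken coefficientwise, as a derivation. -/
def gradSeries (d : σ → Derivation ℤ R R) : Derivation ℤ R⟦X⟧ (σ → S⟦X⟧) where
  toFun A j := mk fun l => grad S d (coeff l A) j
  map_add' A B := by
    ext j l
    simp [grad]
  map_smul' k A := by
    ext j l
    simp [grad, -zsmul_eq_mul]
  map_one_eq_zero' := by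
    ext j l
    by_cases hl : l = 0 <;> simp [grad, coeff_one, hl]
  leibniz' A B := by
    ext j l
    change coeff l (mk fun l => grad S d (coeff l (A * B)) j) =
      coeff l (A • mk (fun l => grad S d (coeff l B) j) + B • mk fun l => grad S d (coeff l A) j)
    rw [Algebra.smul_def, Algebra.smul_def, algebraMap_apply'', algebraMap_apply'',
      mul_comm (map _ B)]
    simp only [grad, coeff_mul, map_sum, Derivation.leibniz, smul_eq_mul, map_add, map_mul,
      coeff_mk, coeff_map, ← Finset.sum_add_distrib, mul_comm (algebraMap R S (coeff _ B))]

theorem vcoeff_gradSeries (d : σ → Derivation ℤ R R) (A : R⟦X⟧) (l : ℕ) :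
    vcoeff l (gradSeries S d A) = grad S d (coeff l A) := by
  ext j
  simp [vcoeff_apply, gradSeries]

end series

section frame
variable {S σ ι : Type*} [CommRing S] [Fintype σ] [Fintype ι]

theorem exists_basis_of_span_eq_top {v : ι → σ → S}
    (hspan : Submodule.span S (Set.range v) = ⊤) (hcard : Fintype.card ι = Fintype.card σ) :
    ∃ b : Module.Basis ι S (σ → S), ⇑b = v := by
  have indep : LinearIndependent S v := by
    cases subsingleton_or_nontrivial S
    · exact linearIndependent_of_subsingleton
    · exact linearIndependent_of_top_le_span_of_card_eq_finrank hspan.ge (by simpa using hcard)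
  exact ⟨.mk indep hspan.ge, Module.Basis.coe_mk _ _⟩

/-- The vectors `e i`, the coefficients of index `1, …, N` of `P` and those of index `1, …, M`
of `O` are as many as the dimension and span, all other coefficients being redundant. -/
structure IsCoeffFrame (e : ι → σ → S) (P O : σ → S⟦X⟧) (N M : ℕ) : Prop where
  card : Fintype.card σ = Fintype.card ι + N + M
  vcoeff_zero_left : vcoeff 0 P = 0
  vcoeff_zero_right : vcoeff 0 O = 0
  tail_left : ∀ l > N, vcoeff l P ∈ Submodule.span S (Set.range e)
  tail_right : ∀ l > M, vcoeff l O ∈ Submodule.span S (Set.range e)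
  eq_top : ∀ Ω : Submodule S (σ → S), (∀ i, e i ∈ Ω) → P ∈ coeffsIn Ω → O ∈ coeffsIn Ω → Ω = ⊤

namespace IsCoeffFrame
variable {e : ι → σ → S} {P O : σ → S⟦X⟧} {N M : ℕ}

theorem exists_basis (h : IsCoeffFrame e P O N M) (B : S⟦X⟧) :
    ∃ b : Module.Basis ((ι ⊕ Fin N) ⊕ Fin M) S (σ → S),
      (∀ i, b (.inl (.inl i)) = e i) ∧
      (∀ i : Fin N, b (.inl (.inr i)) = vcoeff (i + 1) (P + B • O)) ∧
      ∀ j : Fin M, b (.inr j) = vcoeff (j + 1) O := by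
  let v : (ι ⊕ Fin N) ⊕ Fin M → σ → S := Sum.elim
    (Sum.elim e fun i => vcoeff (i + 1) (P + B • O)) fun j => vcoeff (j + 1) O
  suffices hspan : Submodule.span S (Set.range v) = ⊤ by
    obtain ⟨b, hb⟩ := exists_basis_of_span_eq_top hspan (by simp [h.card])
    exact ⟨b, by simp [hb, v]⟩
  set Ω := Submodule.span S (Set.range v)
  have mem : ∀ k, v k ∈ Ω := fun k => Submodule.subset_span ⟨k, rfl⟩
  have e_mem : ∀ i, e i ∈ Ω := fun i => mem (.inl (.inl i))
  have span_e_le : Submodule.span S (Set.range e) ≤ Ω :=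
    Submodule.span_le.mpr (Set.range_subset_iff.mpr e_mem)
  have O_mem : O ∈ coeffsIn Ω := by
    rintro (_ | l)
    · simp [h.vcoeff_zero_right]
    · by_cases hl : l < M
      · exact mem (.inr ⟨l, hl⟩)
      · exact span_e_le (h.tail_right _ (by omega))
  have P_mem : P ∈ coeffsIn Ω := by
    rintro (_ | l)
    · simp [h.vcoeff_zero_left]
    · by_cases hl : l < N
      · rw [eq_sub_of_add_eq (map_add (vcoeff (l + 1)) P (B • O)).symm]
        exact Ω.sub_mem (mem (.inl (.inr ⟨l, hl⟩))) ((coeffsIn Ω).smul_mem B O_mem _)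
      · exact span_e_le (h.tail_left _ (by omega))
  exact h.eq_top Ω e_mem P_mem O_mem

theorem minorIdeal_eq_top (h : IsCoeffFrame e P O N M) {B : S⟦X⟧} {Ω : Submodule S (σ → S)}
    (he : ∀ i, e i ∈ Ω) (hΩ : P + B • O ∈ coeffsIn Ω) :
    minorIdeal (Fintype.card ι + N) Ω = ⊤ := by
  obtain ⟨b, hbe, hbN, -⟩ := h.exists_basis B
  have := minorIdeal_card_eq_top b (Ω := Ω)
    (Sum.rec (fun i => hbe i ▸ he i) fun i => hbN i ▸ hΩ (i + 1))
  simpa using this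

theorem coord_vcoeff_add_smul {b : Module.Basis ((ι ⊕ Fin N) ⊕ Fin M) S (σ → S)}
    (h : IsCoeffFrame e P O N M) (hbe : ∀ i, b (.inl (.inl i)) = e i)
    (hbM : ∀ j : Fin M, b (.inr j) = vcoeff (j + 1) O) (hMN : M ≤ N) (B : S⟦X⟧) (j : Fin M)
    {l : ℕ} (hl : N < l) :
    b.coord (.inr j) (vcoeff l (P + B • O)) = coeff (l - (j + 1)) B := by
  classical
  have coord_eq_zero : ∀ v ∈ Submodule.span S (Set.range e), b.coord (.inr j) v = 0 := by
    have : Submodule.span S (Set.range e) ≤ LinearMap.ker (b.coord (.inr j)) :=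
      Submodule.span_le.mpr (Set.range_subset_iff.mpr fun i => by simp [← hbe i])
    exact this
  have coord_O : ∀ i, b.coord (.inr j) (vcoeff i O) = if i = j + 1 then 1 else 0 := by
    rintro (_ | i)
    · simp [h.vcoeff_zero_right]
    · by_cases hi : i < M
      · rw [← hbM ⟨i, hi⟩]
        simp [Finsupp.single_apply, Fin.ext_iff]
      · rw [coord_eq_zero _ (h.tail_right _ (by omega)), if_neg (by omega)]
  rw [map_add, map_add, coord_eq_zero _ (h.tail_left l hl), zero_add, vcoeff_smul, map_sum,
    Finset.sum_eq_single (l - (j + 1), (j : ℕ) + 1)]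
  · simp [coord_O]
  · rintro ⟨p, q⟩ hp hne
    have hp := Finset.HasAntidiagonal.mem_antidiagonal.mp hp
    have : q ≠ j + 1 := fun hq => hne (by simp only [Prod.mk.injEq] at hp ⊢; omega)
    simp [coord_O, this]
  · intro hp
    exact (hp (Finset.HasAntidiagonal.mem_antidiagonal.mpr (by simp only; omega))).elim

theorem minorIdeal_succ_eq_span (h : IsCoeffFrame e P O N M) (hMN : M ≤ N) (B : S⟦X⟧) :
    minorIdeal (Fintype.card ι + N + 1)
        (Submodule.span S (Set.range e ∪ Set.range fun l => vcoeff l (P + B • O))) =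
      Ideal.span {x | ∃ l > N, ∃ j : Fin M, x = coeff (l - (j + 1)) B} := by
  classical
  set T := Set.range e ∪ Set.range fun l => vcoeff l (P + B • O)
  obtain ⟨b, hbe, hbN, hbM⟩ := h.exists_basis B
  have pivot_mem : ∀ i, b (.inl i) ∈ Submodule.span S T := by
    rintro (i | i) <;> refine Submodule.subset_span ?_
    · exact .inl ⟨i, (hbe i).symm⟩
    · exact .inr ⟨i + 1, (hbN i).symm⟩
  have := minorIdeal_card_succ_eq_span b pivot_mem
  rw [Fintype.card_sum, Fintype.card_fin] at this
  rw [this]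
  refine le_antisymm (Ideal.span_le.mpr ?_) (Ideal.span_mono ?_)
  · rintro _ ⟨_, ⟨i, rfl⟩ | ⟨l, rfl⟩, j, rfl⟩
    · simp [← hbe i]
    · rcases lt_or_ge N l with hl | hl
      · exact Ideal.subset_span ⟨l, hl, j, h.coord_vcoeff_add_smul hbe hbM hMN B j hl⟩
      · rcases l with _ | l
        · simp [vcoeff_smul, h.vcoeff_zero_left, h.vcoeff_zero_right]
        · simp [← hbN ⟨l, hl⟩]
  · rintro _ ⟨l, hl, j, rfl⟩
    exact ⟨_, .inr ⟨l, rfl⟩, j, (h.coord_vcoeff_add_smul hbe hbM hMN B j hl).symm⟩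

end IsCoeffFrame

end frame

section GenericPair
variable {R S σ : Type*} [CommRing R] [CommRing S] [Algebra R S]
  {d : σ → Derivation ℤ R R} {x : ℕ → R} {m N M : ℕ} {U H Hi : R⟦X⟧}

theorem vcoeff_zero_gradSeries {A : R⟦X⟧} (hA : constantCoeff A = 1) :
    vcoeff 0 (gradSeries S d A) = 0 := by
  rw [vcoeff_gradSeries, coeff_zero_eq_constantCoeff_apply, hA]
  ext j
  simp [grad]

theorem constantCoeff_eq_one_of_mul_eq_one {A B : R⟦X⟧} (hA : constantCoeff A = 1)
    (hAB : A * B = 1) : constantCoeff B = 1 := by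
  simpa [hA] using congrArg constantCoeff hAB

theorem smul_eq_map_mul (A : R⟦X⟧) (B : S⟦X⟧) : A • B = map (algebraMap R S) A * B := by
  rw [Algebra.smul_def, algebraMap_apply'']

theorem smul_eq_map_smul (A : R⟦X⟧) (P : σ → S⟦X⟧) : A • P = map (algebraMap R S) A • P :=
  funext fun j => smul_eq_map_mul A (P j)

theorem gradSeries_pow_mul_pow (hHi : H * Hi = 1) (a b : ℕ) :
    gradSeries S d (U ^ (a + 1) * H ^ (b + 1)) = (U ^ a * H ^ (b + 1)) •
      (((a + 1 : ℕ) : S) • gradSeries S d U +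
        map (algebraMap R S) (U * Hi) • ((b + 1 : ℕ) : S) • gradSeries S d H) := by
  have nsmul_eq : ∀ (c : ℕ) (P : σ → S⟦X⟧), c • P = (c : S) • P := fun c P =>
    (Nat.cast_smul_eq_nsmul S c P).symm
  have pow_H : H ^ b = H ^ (b + 1) * Hi := by rw [pow_succ, mul_assoc, hHi, mul_one]
  rw [Derivation.leibniz, Derivation.leibniz_pow, Derivation.leibniz_pow, Nat.add_sub_cancel,
    Nat.add_sub_cancel, nsmul_eq, nsmul_eq, smul_comm _ (U ^ a), smul_comm _ (H ^ b), smul_smul,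
    smul_smul, ← smul_eq_map_smul, smul_add, smul_smul, pow_H, add_comm]
  congr 2 <;> ring

theorem grad_mem_span_range (hS : Function.Surjective (algebraMap R S))
    (hx : ∀ k < m, algebraMap R S (x k) = 0) {f : R} (hf : f ∈ Ideal.span (x '' Set.Iio m)) :
    grad S d f ∈ Submodule.span S (Set.range fun k : Fin m => grad S d (x k)) := by
  have hrange : (Set.range fun k : Fin m => grad S d (x k)) = grad S d '' (x '' Set.Iio m) := by
    ext
    simp [Fin.exists_iff]
  rw [hrange]
  exact (coe_span_grad_image hS (Set.forall_mem_image.mpr hx)).ge ⟨f, hf, rfl⟩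

/-- Two power series that are generic polynomials of degrees `N` and `M` with constant term `1`
modulo `x_0, …, x_{m-1}`: the gradients of their coefficients span everything, although their
number, counting those of `x_0, …, x_{m-1}`, is only the dimension. -/
structure GenericPair [Fintype σ] (d : σ → Derivation ℤ R R) (x : ℕ → R) (m N M : ℕ)
    (U H : R⟦X⟧) : Prop where
  card : Fintype.card σ = m + N + M
  constantCoeff_left : constantCoeff U = 1
  constantCoeff_right : constantCoeff H = 1
  tail_left : ∀ l > N, coeff l U ∈ Ideal.span (x '' Set.Iio m)
  tail_right : ∀ l > M, coeff l H ∈ Ideal.span (x '' Set.Iio m)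
  eq_top : ∀ Ω : Submodule R (σ → R),
    gradSeries R d U ∈ coeffsIn Ω → gradSeries R d H ∈ coeffsIn Ω → Ω = ⊤

variable [Fintype σ]

theorem GenericPair.symm (h : GenericPair d x m N M U H) : GenericPair d x m M N H U where
  card := by rw [h.card]; omega
  constantCoeff_left := h.constantCoeff_right
  constantCoeff_right := h.constantCoeff_left
  tail_left := h.tail_right
  tail_right := h.tail_left
  eq_top Ω hH hU := h.eq_top Ω hU hH

theorem GenericPair.div (h : GenericPair d x m N M U H) (hHi : H * Hi = 1) (hMN : M ≤ N)
    (hx : ∀ i < M, Associated (x (m + i)) (coeff (N - i) (U * Hi))) :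
    GenericPair d x (m + M) (N - M) M (U * Hi) H := by
  have hU : U * Hi * H = U := by rw [mul_assoc, mul_comm Hi, hHi, mul_one]
  have mono : Ideal.span (x '' Set.Iio m) ≤ Ideal.span (x '' Set.Iio (m + M)) :=
    Ideal.span_mono (Set.image_mono (Set.Iio_subset_Iio (by omega)))
  refine
    { card := by rw [h.card]; omega
      constantCoeff_left := ?_
      constantCoeff_right := h.constantCoeff_right
      tail_left := ?_
      tail_right := fun l hl => mono (h.tail_right l hl)
      eq_top := fun Ω hA hH => h.eq_top Ω ?_ hH }
  · rw [map_mul, h.constantCoeff_left, one_mul]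
    exact constantCoeff_eq_one_of_mul_eq_one h.constantCoeff_right hHi
  · refine coeff_mem_of_mul hMN h.constantCoeff_right (fun l hl => mono (h.tail_right l hl))
      (fun l hl => ?_) fun l hl hlN => ?_
    · rw [hU]
      exact mono (h.tail_left l hl)
    · have := hx (N - l) (by omega)
      rw [Nat.sub_sub_self hlN] at this
      exact Ideal.mem_of_dvd _ this.dvd (Ideal.subset_span ⟨_, Set.mem_Iio.mpr (by omega), rfl⟩)
  · rw [← hU, Derivation.leibniz]
    exact add_mem ((coeffsIn Ω).smul_mem _ hH) ((coeffsIn Ω).smul_mem _ hA)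

theorem GenericPair.eq_top_of_algebra (h : GenericPair d x m N M U H)
    {Ω : Submodule S (σ → S)} (hU : gradSeries S d U ∈ coeffsIn Ω)
    (hH : gradSeries S d H ∈ coeffsIn Ω) : Ω = ⊤ := by
  classical
  let Ω' : Submodule R (σ → R) :=
    (Ω.restrictScalars R).comap ((Algebra.linearMap R S).compLeft σ)
  have mem_Ω' : ∀ A, gradSeries S d A ∈ coeffsIn Ω → gradSeries R d A ∈ coeffsIn Ω' := by
    intro A hA l
    rw [vcoeff_gradSeries]
    have := hA l
    rwa [vcoeff_gradSeries] at this
  have hΩ' := h.eq_top Ω' (mem_Ω' U hU) (mem_Ω' H hH)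
  rw [← top_le_iff, ← (Pi.basisFun S σ).span_eq, Submodule.span_le, Set.range_subset_iff]
  intro j
  have single_mem : Pi.single j 1 ∈ Ω' := hΩ' ▸ Submodule.mem_top
  have basisFun_eq : Pi.basisFun S σ j = (Algebra.linearMap R S).compLeft σ (Pi.single j 1) := by
    ext k
    simp [Pi.single_apply, apply_ite (algebraMap R S)]
  rw [basisFun_eq]
  exact single_mem

theorem GenericPair.isCoeffFrame (h : GenericPair d x m N M U H)
    (hS : Function.Surjective (algebraMap R S)) (hx : ∀ k < m, algebraMap R S (x k) = 0)
    {u v : S} (hu : IsUnit u) (hv : IsUnit v) :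
    IsCoeffFrame (fun k : Fin m => grad S d (x k)) (u • gradSeries S d U)
      (v • gradSeries S d H) N M where
  card := by simpa using h.card
  vcoeff_zero_left := by rw [map_smul, vcoeff_zero_gradSeries h.constantCoeff_left, smul_zero]
  vcoeff_zero_right := by rw [map_smul, vcoeff_zero_gradSeries h.constantCoeff_right, smul_zero]
  tail_left l hl := by
    rw [map_smul, vcoeff_gradSeries]
    exact Submodule.smul_mem _ u (grad_mem_span_range hS hx (h.tail_left l hl))
  tail_right l hl := by
    rw [map_smul, vcoeff_gradSeries]
    exact Submodule.smul_mem _ v (grad_mem_span_range hS hx (h.tail_right l hl))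
  eq_top Ω _ hP hO := h.eq_top_of_algebra
    (fun l => (Ω.smul_mem_iff_of_isUnit hu).mp (map_smul (vcoeff l) u _ ▸ hP l))
    (fun l => (Ω.smul_mem_iff_of_isUnit hv).mp (map_smul (vcoeff l) v _ ▸ hO l))

end GenericPair

section stepIdeal
variable {R S σ : Type*} [CommRing R] [CommRing S] [Algebra R S]
  {d : σ → Derivation ℤ R R} {x : ℕ → R} {m N M a b : ℕ} {U H Hi K : R⟦X⟧}

/-- The ideal generated by `x_0, …, x_{m-1}` and the coefficients of `K` of positive index. -/
def stepIdeal (x : ℕ → R) (m : ℕ) (K : R⟦X⟧) : Ideal R :=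
  Ideal.span (x '' Set.Iio m ∪ Set.range fun l => coeff (l + 1) K)

theorem span_grad_eq_span_vcoeff (hK : constantCoeff K = 1) {C : S⟦X⟧} (hC : IsUnit C)
    {Q : σ → S⟦X⟧} (hQ : gradSeries S d K = C • Q) :
    Submodule.span S (grad S d '' (x '' Set.Iio m ∪ Set.range fun l => coeff (l + 1) K)) =
      Submodule.span S
        (Set.range (fun k : Fin m => grad S d (x k)) ∪ Set.range fun l => vcoeff l Q) := by
  refine le_antisymm (Submodule.span_le.mpr ?_) (Submodule.span_le.mpr ?_)
  · rintro _ ⟨_, ⟨k, hk, rfl⟩ | ⟨l, rfl⟩, rfl⟩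
    · exact Submodule.subset_span (.inl ⟨⟨k, hk⟩, rfl⟩)
    · rw [← vcoeff_gradSeries, hQ]
      exact (coeffsIn _).smul_mem C (fun l => Submodule.subset_span (.inr ⟨l, rfl⟩)) (l + 1)
  · set Ω := Submodule.span S
      (grad S d '' (x '' Set.Iio m ∪ Set.range fun l => coeff (l + 1) K))
    have smul_mem : C • Q ∈ coeffsIn Ω := by
      rw [← hQ]
      rintro (_ | l)
      · simp [vcoeff_zero_gradSeries hK]
      · rw [vcoeff_gradSeries]
        exact Submodule.subset_span ⟨_, .inr ⟨l, rfl⟩, rfl⟩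
    rintro _ (⟨k, rfl⟩ | ⟨l, rfl⟩)
    · exact Submodule.subset_span ⟨_, .inl ⟨k, k.2, rfl⟩, rfl⟩
    · exact ((coeffsIn Ω).smul_mem_iff_of_isUnit hC).mp smul_mem l

theorem span_coeff_eq_span_coeff_sub {B H : S⟦X⟧} (hMN : M ≤ N) (hH₀ : constantCoeff H = 1)
    (hH : ∀ l > M, coeff l H = 0) (hBH : ∀ l > N, coeff l (B * H) = 0) :
    Ideal.span {y | ∃ l > N, ∃ j : Fin M, y = coeff (l - (j + 1)) B} =
      Ideal.span (Set.range fun i : Fin M => coeff (N - i) B) := by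
  refine le_antisymm (Ideal.span_le.mpr ?_) (Ideal.span_mono ?_)
  · rintro _ ⟨l, hl, j, rfl⟩
    refine coeff_mem_of_mul hMN hH₀ (fun l hl => ?_) (fun l hl => ?_) (fun l hl hlN => ?_) _ ?_
    · simp [hH l hl]
    · simp [hBH l hl]
    · exact Ideal.subset_span ⟨⟨N - l, by omega⟩, by simp [Nat.sub_sub_self hlN]⟩
    · have := j.2
      omega
  · rintro _ ⟨i, rfl⟩
    exact ⟨N + 1, by simp, i, by simp⟩

theorem stepIdeal_add {y : ℕ → R} (hx : ∀ i < M, Associated (x (m + i)) (y i)) :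
    stepIdeal x (m + M) K =
      Ideal.span (Set.range fun i : Fin M => y i) ⊔ stepIdeal x m K := by
  have mono : stepIdeal x m K ≤ stepIdeal x (m + M) K :=
    Ideal.span_mono (Set.union_subset_union_left _
      (Set.image_mono (Set.Iio_subset_Iio (Nat.le_add_right m M))))
  refine le_antisymm (Ideal.span_le.mpr ?_) (sup_le (Ideal.span_le.mpr ?_) mono)
  · rintro _ (⟨k, hk, rfl⟩ | ⟨l, rfl⟩)
    · rcases lt_or_ge k m with hkm | hmk
      · exact Ideal.mem_sup_right (Ideal.subset_span (.inl ⟨k, hkm, rfl⟩))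
      · obtain ⟨i, rfl⟩ := Nat.exists_eq_add_of_le hmk
        have hi : i < M := Nat.lt_of_add_lt_add_left hk
        exact Ideal.mem_sup_left (Ideal.mem_of_dvd _ (hx i hi).symm.dvd
          (Ideal.subset_span ⟨⟨i, hi⟩, rfl⟩))
    · exact Ideal.mem_sup_right (Ideal.subset_span (.inr ⟨l, rfl⟩))
  · rintro _ ⟨i, rfl⟩
    exact Ideal.mem_of_dvd _ (hx i i.2).dvd
      (Ideal.subset_span (.inl ⟨m + i, by simp, rfl⟩))

variable [Fintype σ]

theorem GenericPair.minorExt_stepIdeal (h : GenericPair d x m N M U H) (hHi : H * Hi = 1)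
    (hS : Function.Surjective (algebraMap R S)) (hK : U ^ (a + 1) * H ^ (b + 1) = K)
    (hker : RingHom.ker (algebraMap R S) = stepIdeal x m K) (k : ℕ) :
    minorExt d k (stepIdeal x m K) = (minorIdeal k (Submodule.span S
      (Set.range (fun k : Fin m => grad S d (x k)) ∪
        Set.range fun l => vcoeff l (((a + 1 : ℕ) : S) • gradSeries S d U +
          map (algebraMap R S) (U * Hi) • ((b + 1 : ℕ) : S) • gradSeries S d H)))).comap
        (algebraMap R S) := by
  have constantCoeff_factor : constantCoeff (U ^ a * H ^ (b + 1)) = 1 := by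
    simp [h.constantCoeff_left, h.constantCoeff_right]
  have constantCoeff_K : constantCoeff K = 1 := by
    simp [← hK, h.constantCoeff_left, h.constantCoeff_right]
  have isUnit_factor : IsUnit (map (algebraMap R S) (U ^ a * H ^ (b + 1))) :=
    (isUnit_iff_constantCoeff.mpr (constantCoeff_factor ▸ isUnit_one)).map _
  rw [stepIdeal, minorExt_span_eq_comap hS hker, span_grad_eq_span_vcoeff constantCoeff_K
    isUnit_factor]
  rw [← smul_eq_map_smul, ← hK, gradSeries_pow_mul_pow hHi]

theorem GenericPair.minorIdeal_succ_eq_map (h : GenericPair d x m N M U H) (hHi : H * Hi = 1)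
    (hS : Function.Surjective (algebraMap R S)) (hx : ∀ k < m, algebraMap R S (x k) = 0)
    {u v : S} (hu : IsUnit u) (hv : IsUnit v) (hMN : M ≤ N) :
    minorIdeal (m + N + 1) (Submodule.span S
      (Set.range (fun k : Fin m => grad S d (x k)) ∪ Set.range fun l => vcoeff l
        (u • gradSeries S d U + map (algebraMap R S) (U * Hi) • v • gradSeries S d H))) =
      (Ideal.span (Set.range fun i : Fin M => coeff (N - i) (U * Hi))).map (algebraMap R S) := by
  have hU : U * Hi * H = U := by rw [mul_assoc, mul_comm Hi, hHi, mul_one]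
  have coeff_map_eq_zero : ∀ {A : R⟦X⟧} {l}, coeff l A ∈ Ideal.span (x '' Set.Iio m) →
      coeff l (map (algebraMap R S) A) = 0 := by
    intro A l hl
    have : Ideal.span (x '' Set.Iio m) ≤ RingHom.ker (algebraMap R S) :=
      Ideal.span_le.mpr (Set.image_subset_iff.mpr fun k hk => hx k hk)
    rw [coeff_map]
    exact this hl
  have minors_eq := (h.isCoeffFrame hS hx hu hv).minorIdeal_succ_eq_span hMN
    (map (algebraMap R S) (U * Hi))
  rw [Fintype.card_fin] at minors_eq
  rw [minors_eq, span_coeff_eq_span_coeff_sub (H := map (algebraMap R S) H) hMN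
    (by rw [← coeff_zero_eq_constantCoeff_apply, coeff_map, coeff_zero_eq_constantCoeff_apply,
      h.constantCoeff_right, map_one])
    (fun l hl => coeff_map_eq_zero (h.tail_right l hl))
    (fun l hl => by rw [← map_mul, hU]; exact coeff_map_eq_zero (h.tail_left l hl)),
    Ideal.map_span, ← Set.range_comp]
  simp only [coeff_map, Function.comp_def]

theorem GenericPair.minorExt_stepIdeal_eq_top (h : GenericPair d x m N M U H)
    (hHi : H * Hi = 1) (ha : IsUnit ((a + 1 : ℕ) : R)) (hb : IsUnit ((b + 1 : ℕ) : R))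
    (hK : U ^ (a + 1) * H ^ (b + 1) = K) : minorExt d (m + N) (stepIdeal x m K) = ⊤ := by
  have hS : Function.Surjective (algebraMap R (R ⧸ stepIdeal x m K)) :=
    Ideal.Quotient.mk_surjective
  have hker : RingHom.ker (algebraMap R (R ⧸ stepIdeal x m K)) = stepIdeal x m K := Ideal.mk_ker
  have frame := h.isCoeffFrame hS
    (fun k hk => hker.ge (Ideal.subset_span (.inl ⟨k, hk, rfl⟩)))
    (ha.map (algebraMap R _)) (hb.map (algebraMap R _))
  rw [map_natCast, map_natCast] at frame
  rw [h.minorExt_stepIdeal hHi hS hK hker, Ideal.comap_eq_top_iff]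
  rw [show m + N = Fintype.card (Fin m) + N by rw [Fintype.card_fin]]
  exact frame.minorIdeal_eq_top (fun i => Submodule.subset_span (.inl ⟨i, rfl⟩))
    (fun l => Submodule.subset_span (.inr ⟨l, rfl⟩))

theorem GenericPair.minorExt_stepIdeal_succ (h : GenericPair d x m N M U H)
    (hHi : H * Hi = 1) (ha : IsUnit ((a + 1 : ℕ) : R)) (hb : IsUnit ((b + 1 : ℕ) : R))
    (hK : U ^ (a + 1) * H ^ (b + 1) = K) (hMN : M ≤ N)
    (hx : ∀ i < M, Associated (x (m + i)) (coeff (N - i) (U * Hi))) :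
    minorExt d (m + N + 1) (stepIdeal x m K) = stepIdeal x (m + M) K := by
  have hS : Function.Surjective (algebraMap R (R ⧸ stepIdeal x m K)) :=
    Ideal.Quotient.mk_surjective
  have hker : RingHom.ker (algebraMap R (R ⧸ stepIdeal x m K)) = stepIdeal x m K := Ideal.mk_ker
  have minors_eq := h.minorIdeal_succ_eq_map hHi hS
    (fun k hk => hker.ge (Ideal.subset_span (.inl ⟨k, hk, rfl⟩)))
    (ha.map (algebraMap R _)) (hb.map (algebraMap R _)) hMN
  rw [map_natCast, map_natCast] at minors_eq
  rw [h.minorExt_stepIdeal hHi hS hK hker, minors_eq, stepIdeal_add hx,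
    Ideal.comap_map_of_surjective _ hS, ← RingHom.ker_eq_comap_bot, hker]

end stepIdeal

section reversal
variable {R R' : Type*} [CommRing R] [CommRing R'] {m : ℕ} {v : ℕ → R}

/-- The reversal `1 + v_{m-1} X + ⋯ + v_0 X^m` of `X^m + v_{m-1} X^{m-1} + ⋯ + v_0`, as a power
series. -/
def revMonic (m : ℕ) (v : ℕ → R) : R⟦X⟧ := 1 + ∑ k ∈ Finset.Icc 1 m, C (v (m - k)) * X ^ k

theorem coeff_revMonic {l : ℕ} (hl : 0 < l) :
    coeff l (revMonic m v) = if l ≤ m then v (m - l) else 0 := by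
  simp [revMonic, coeff_one, hl.ne', Nat.succ_le_iff, hl]

theorem constantCoeff_revMonic : constantCoeff (revMonic m v) = 1 := by
  rw [revMonic, map_add, map_one, map_sum, add_eq_left]
  refine Finset.sum_eq_zero fun k hk => ?_
  simp [Nat.one_le_iff_ne_zero.mp (Finset.mem_Icc.mp hk).1]

theorem map_revMonic (φ : R →+* R') : map φ (revMonic m v) = revMonic m (φ ∘ v) := by
  simp [revMonic]

theorem coeff_X_pow_add_sum (i : ℕ) : (Polynomial.X ^ m +
    ∑ i ∈ Finset.range m, Polynomial.C (v i) * Polynomial.X ^ i).coeff i =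
      if i = m then 1 else if i < m then v i else 0 := by
  obtain rfl | h := eq_or_ne i m <;> simp [Polynomial.coeff_X_pow, *]

theorem revMonic_eq_coe_reflect : revMonic m v = (Polynomial.reflect m (Polynomial.X ^ m +
    ∑ i ∈ Finset.range m, Polynomial.C (v i) * Polynomial.X ^ i) : R⟦X⟧) := by
  ext l
  rw [Polynomial.coeff_coe, Polynomial.coeff_reflect, coeff_X_pow_add_sum]
  obtain rfl | hl := l.eq_zero_or_pos
  · simp [constantCoeff_revMonic]
  · rw [coeff_revMonic hl]
    by_cases hlm : l ≤ m
    · rw [Polynomial.revAt_le hlm, if_pos hlm, if_neg (by omega), if_pos (by omega)]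
    · rw [Polynomial.revAt_eq_self_of_lt (by omega), if_neg hlm, if_neg (by omega),
        if_neg (by omega)]

theorem natDegree_X_pow_add_sum_le : (Polynomial.X ^ m +
    ∑ i ∈ Finset.range m, Polynomial.C (v i) * Polynomial.X ^ i).natDegree ≤ m := by
  rw [Polynomial.natDegree_le_iff_coeff_eq_zero]
  intro i hi
  rw [coeff_X_pow_add_sum, if_neg hi.ne', if_neg hi.not_gt]

end reversal

section toeplitz
variable {R : Type} [CommRing R] {N : ℕ}

theorem coeff_mul_eq_sum_range {i : ℕ} (hi : i < N) (A B : R⟦X⟧) :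
    coeff i (A * B) = ∑ l ∈ Finset.range N, coeff i (A * X ^ l) * coeff l B := by
  rw [mul_comm, coeff_mul, Finset.Nat.sum_antidiagonal_eq_sum_range_succ_mk]
  simp only [coeff_mul_X_pow', ite_mul, zero_mul]
  rw [← Finset.sum_filter]
  refine Finset.sum_congr (Finset.ext fun l => ?_) fun l _ => mul_comm _ _
  simp only [Finset.mem_range, Finset.mem_filter]
  omega

/-- The `N × N` matrix of multiplication by a power series on `R⟦X⟧ / X^N`, in the basis of the
powers of `X`. -/
def toeplitzHom (N : ℕ) : R⟦X⟧ →+* Matrix (Fin N) (Fin N) R where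
  toFun A := Matrix.of fun i j => coeff i (A * X ^ (j : ℕ))
  map_one' := by
    ext i j
    simp [coeff_X_pow, Matrix.one_apply, Fin.ext_iff]
  map_zero' := by
    ext i j
    simp
  map_add' A B := by
    ext i j
    simp [add_mul]
  map_mul' A B := by
    ext i j
    rw [Matrix.mul_apply, Matrix.of_apply, mul_assoc, coeff_mul_eq_sum_range i.2]
    exact (Fin.sum_univ_eq_sum_range
      (fun l => coeff i (A * X ^ l) * coeff l (B * X ^ (j : ℕ))) N).symm

theorem toeplitzHom_apply (A : R⟦X⟧) (i j : Fin N) :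
    toeplitzHom N A i j = coeff i (A * X ^ (j : ℕ)) := rfl

theorem toeplitzHom_X : toeplitzHom N (X : R⟦X⟧) = lowerShift R N := by
  ext i j
  simp [toeplitzHom_apply, lowerShift, ← pow_succ', coeff_X_pow]

theorem toeplitzHom_C_mul (c : R) (A : R⟦X⟧) :
    toeplitzHom N (C c * A) = c • toeplitzHom N A := by
  ext i j
  simp [toeplitzHom_apply, mul_assoc]

theorem lowerToeplitz_eq_toeplitzHom_revMonic (m : ℕ) (v : ℕ → R) :
    lowerToeplitz N m v = toeplitzHom N (revMonic m v) := by
  simp only [lowerToeplitz, revMonic, map_add, map_one, map_sum, toeplitzHom_C_mul, map_pow,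
    toeplitzHom_X]

theorem lowerToeplitz_eq_toeplitzHom {v : ℕ → R} {A : R⟦X⟧} (hA₀ : constantCoeff A = 1)
    (hA : ∀ l, 0 < l → l < N → v (N - l) = coeff l A) :
    lowerToeplitz N N v = toeplitzHom N A := by
  have coeff_eq : ∀ l < N, coeff l (revMonic N v) = coeff l A := by
    rintro (_ | l) hl
    · simp [constantCoeff_revMonic, hA₀]
    · rw [coeff_revMonic l.succ_pos, if_pos hl.le, hA _ l.succ_pos hl]
  ext i j
  rw [lowerToeplitz_eq_toeplitzHom_revMonic, toeplitzHom_apply, toeplitzHom_apply,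
    coeff_mul_X_pow', coeff_mul_X_pow', coeff_eq _ (by omega)]

theorem toeplitzCoeff_toeplitzHom {k : ℕ} (hk : k < N) (A : R⟦X⟧) :
    toeplitzCoeff (toeplitzHom N A) k = coeff k A := by
  simp [toeplitzCoeff, hk, toeplitzHom_apply]

theorem inv_toeplitzHom {A B : R⟦X⟧} (h : A * B = 1) :
    (toeplitzHom N A)⁻¹ = toeplitzHom N B :=
  Matrix.inv_eq_right_inv (by rw [← map_mul, h, map_one])

end toeplitz

section coefficientRing
variable (n r : ℕ)

/-- The reversal `F = 1 + a_{n-1} X + ⋯ + a_0 X^n` of the generic polynomial `f`. -/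
def revF : (CoeffRing n r)⟦X⟧ := revMonic n (aVar n r)

/-- The reversal `G = 1 + b_{r-1} X + ⋯ + b_0 X^r` of the generic polynomial `g`. -/
def revG : (CoeffRing n r)⟦X⟧ := revMonic r (bVar n r)

/-- The power series `1 / F`. -/
def revFInv : (CoeffRing n r)⟦X⟧ := invOfUnit (revF n r) 1

/-- The power series `1 / G`. -/
def revGInv : (CoeffRing n r)⟦X⟧ := invOfUnit (revG n r) 1

theorem revF_mul_revFInv : revF n r * revFInv n r = 1 :=
  mul_invOfUnit _ _ constantCoeff_revMonic

theorem revG_mul_revGInv : revG n r * revGInv n r = 1 :=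
  mul_invOfUnit _ _ constantCoeff_revMonic

theorem constantCoeff_revF_mul_revGInv : constantCoeff (revF n r * revGInv n r) = 1 := by
  rw [map_mul, revF, constantCoeff_revMonic, one_mul,
    constantCoeff_eq_one_of_mul_eq_one constantCoeff_revMonic (revG_mul_revGInv n r)]

theorem coeff_revF_mul_revG (l : ℕ) :
    coeff l (revF n r * revG n r) = cPoly n r (Polynomial.revAt (n + r) l) := by
  rw [revF, revG, revMonic_eq_coe_reflect, revMonic_eq_coe_reflect, ← Polynomial.coe_mul,
    ← Polynomial.reflect_mul _ _ natDegree_X_pow_add_sum_le natDegree_X_pow_add_sum_le,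
    Polynomial.coeff_coe, Polynomial.coeff_reflect]
  rfl

theorem cPoly_eq_zero {j : ℕ} (hj : n + r < j) : cPoly n r j = 0 :=
  Polynomial.coeff_eq_zero_of_natDegree_lt <| hj.trans_le' <|
    Polynomial.natDegree_mul_le_of_le natDegree_X_pow_add_sum_le natDegree_X_pow_add_sum_le

theorem dTop_eq_coeff {j : ℕ} (hj : 0 < j) (hjn : j ≤ n) :
    dTop n r j = coeff j (revF n r * revGInv n r) := by
  induction j using Nat.strong_induction_on with
  | _ j ih =>
    set D := revF n r * revGInv n r with hD
    have coeff_F : coeff j (revF n r) = aVar n r (n - j) := by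
      rw [revF, coeff_revMonic hj, if_pos hjn]
    have D_mul_G : D * revG n r = revF n r := by
      rw [hD, mul_assoc, mul_comm (revGInv n r), revG_mul_revGInv, mul_one]
    rw [← D_mul_G, coeff_mul, Finset.Nat.sum_antidiagonal_eq_sum_range_succ_mk,
      Finset.sum_range_succ, Finset.range_eq_Ico, Finset.sum_eq_sum_Ico_succ_bot hj] at coeff_F
    simp only [Nat.sub_self, Nat.sub_zero, coeff_zero_eq_constantCoeff_apply,
      constantCoeff_revF_mul_revGInv, hD, revG, constantCoeff_revMonic, one_mul, mul_one] at coeff_F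
    rw [coeff_revMonic hj] at coeff_F
    rw [dTop, ← coeff_F, Finset.sum_attach (Finset.Ioo 0 j) (fun i => dTop n r i *
      (if j - i ≤ r then bVar n r (r - (j - i)) else 0))]
    have sum_eq : ∑ i ∈ Finset.Ioo 0 j,
        dTop n r i * (if j - i ≤ r then bVar n r (r - (j - i)) else 0) =
        ∑ i ∈ Finset.Ico (0 + 1) j, coeff i D * coeff (j - i) (revG n r) := by
      refine Finset.sum_congr rfl fun i hi => ?_
      obtain ⟨hi₀, hij⟩ := Finset.mem_Ioo.mp hi
      rw [ih i hij hi₀ (by omega), revG, coeff_revMonic (Nat.sub_pos_of_lt hij)]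
    rw [sum_eq, hD, revG]
    ring

variable (q : ℕ)

theorem matBD_eq_toeplitzHom :
    matBD n r q = toeplitzHom n (revGInv n r ^ q * (revF n r * revGInv n r)) := by
  have hD : matDhat n r = toeplitzHom n (revF n r * revGInv n r) := by
    refine lowerToeplitz_eq_toeplitzHom (constantCoeff_revF_mul_revGInv n r) fun l hl hln => ?_
    rw [dPoly, Nat.sub_sub_self hln.le, dTop_eq_coeff n r hl hln.le]
  rw [matBD, hD, matB, lowerToeplitz_eq_toeplitzHom_revMonic, ← revG,
    inv_toeplitzHom (revG_mul_revGInv n r), ← map_pow, ← map_mul]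

theorem matBD_series_mul_inv : revGInv n r ^ q * (revF n r * revGInv n r) *
    (revG n r * (revFInv n r * revG n r ^ q)) = 1 :=
  calc
    _ = (revG n r * revGInv n r) ^ (q + 1) * (revF n r * revFInv n r) := by ring
    _ = 1 := by rw [revG_mul_revGInv, revF_mul_revFInv, one_pow, one_mul]

theorem inv_matBD_eq_toeplitzHom :
    (matBD n r q)⁻¹ = toeplitzHom n (revG n r * (revFInv n r * revG n r ^ q)) := by
  rw [matBD_eq_toeplitzHom, inv_toeplitzHom (matBD_series_mul_inv n r q)]

theorem betaPoly_eq_coeff {k : ℕ} (hk : 0 < k) (hkn : k ≤ n) :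
    betaPoly n r q k = coeff (n - k) (revG n r * (revFInv n r * revG n r ^ q)) := by
  rw [betaPoly, inv_matBD_eq_toeplitzHom, toeplitzCoeff_toeplitzHom (by omega)]

theorem inv_matBD_eq_lowerToeplitz :
    (matBD n r q)⁻¹ = lowerToeplitz n n (betaPoly n r q) := by
  rw [inv_matBD_eq_toeplitzHom]
  refine (lowerToeplitz_eq_toeplitzHom ?_ fun l hl hln => ?_).symm
  · rw [map_mul, map_mul, map_pow, revG, constantCoeff_revMonic, one_pow, one_mul, mul_one,
      constantCoeff_eq_one_of_mul_eq_one constantCoeff_revMonic (revF_mul_revFInv n r)]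
  · rw [betaPoly_eq_coeff n r q (by omega) (by omega), Nat.sub_sub_self hln.le]

end coefficientRing

section partialDerivatives

/-- The derivations of a commutative ring over `ℤ`, with the instances derived from its ring
structure even where its type provides others. -/
abbrev IntDerivation (R : Type*) [CommRing R] : Type _ := Derivation ℤ R R

theorem derivation_mul_inv_pow {A R M : Type*} [CommRing A] [CommRing R] [Algebra A R]
    [AddCommGroup M] [Module A M] [Module R M] (D : Derivation A R M) {f g gi : R}
    (h : g * gi = 1) (k : ℕ) :
    D (f * gi ^ k) = gi ^ k • D f - k • (f * gi ^ (k + 1)) • D g := by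
  have D_gi : D gi = -gi ^ 2 • D g := D.leibniz_of_mul_eq_one ((mul_comm gi g).trans h)
  rw [D.leibniz, D.leibniz_pow, D_gi, add_comm, sub_eq_add_neg]
  congr 1
  obtain _ | k := k
  · simp
  · rw [smul_comm f, ← smul_neg, neg_smul, smul_neg, smul_neg, smul_smul, smul_smul,
      Nat.add_sub_cancel]
    ring_nf

theorem gradSeries_map {R R' σ : Type*} [CommRing R] [CommRing R'] {φ : R →+* R'}
    {d : σ → Derivation ℤ R R} {d' : σ → Derivation ℤ R' R'}
    (hd : ∀ j a, d' j (φ a) = φ (d j a)) (A : R⟦X⟧) (j : σ) :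
    gradSeries R' d' (map φ A) j = map φ (gradSeries R d A j) := by
  ext l
  simp [gradSeries, grad, hd]

theorem gradSeries_revMonic {R σ : Type*} [CommRing R] (d : σ → Derivation ℤ R R) (m : ℕ)
    (v : ℕ → R) (j : σ) : gradSeries R d (revMonic m v) j =
      ∑ i ∈ Finset.range m, C (d j (v i)) * X ^ (m - i) := by
  have grad_X : gradSeries R d X = 0 := by
    ext j l
    by_cases hl : l = 1 <;> simp [gradSeries, grad, coeff_X, hl]
  have grad_C (c : R) : gradSeries R d (C c) j = C (d j c) := by
    ext l
    by_cases hl : l = 0 <;> simp [gradSeries, grad, coeff_C, hl]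
  rw [revMonic, map_add, map_sum, Derivation.map_one_eq_zero, zero_add, Finset.sum_apply]
  have grad_term (k : ℕ) :
      gradSeries R d (C (v (m - k)) * X ^ k) j = C (d j (v (m - k))) * X ^ k := by
    rw [Derivation.leibniz, Derivation.leibniz_pow, smul_eq_map_smul (X ^ (k - 1)), grad_X,
      smul_zero, smul_zero, smul_eq_map_smul, smul_eq_map_smul, smul_zero, zero_add,
      Pi.smul_apply, grad_C, Algebra.algebraMap_self, PowerSeries.map_id, id, smul_eq_mul, mul_comm]
  rw [Finset.sum_congr rfl fun k _ => grad_term k, ← Finset.sum_range_reflect,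
    Finset.range_eq_Ico, ← Finset.Ico_add_one_right_eq_Icc, ← Finset.sum_Ico_add' _ 0 m 1]
  refine Finset.sum_congr rfl fun k hk => ?_
  rw [Nat.sub_sub, add_comm 1, Nat.sub_sub_self (Finset.mem_Ico.mp hk).2]

theorem derivation_coeff_mul_inv_pow {R σ : Type*} [CommRing R]
    {d : σ → Derivation ℤ R R} {j : σ} {F G Gi : R⟦X⟧} {e L : ℕ} (hGi : G * Gi = 1)
    (hF : gradSeries R d F j = 0) (hG : gradSeries R d G j = X ^ e) (k : ℕ) (he : e ≤ L) :
    d j (coeff L (F * Gi ^ k)) = (-k : ℤ) • coeff (L - e) (F * Gi ^ (k + 1)) := by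
  have h := congrFun
    (congrArg (vcoeff L) (derivation_mul_inv_pow (gradSeries R d) (f := F) hGi k)) j
  rw [vcoeff_gradSeries, smul_eq_map_smul, smul_eq_map_smul, Algebra.algebraMap_self,
    PowerSeries.map_id, vcoeff_apply] at h
  refine h.trans ?_
  simp only [Pi.sub_apply, Pi.smul_apply, id, hF, hG, smul_eq_mul, mul_zero, zero_sub,
    map_neg, map_nsmul, coeff_mul_X_pow', if_pos he, neg_smul, natCast_zsmul]

variable (n r : ℕ)

/-- The partial derivatives of the coefficient ring, over `ℤ` like those of germs. -/
def polyDeriv (j : Fin n ⊕ Fin r) : IntDerivation (CoeffRing n r) where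
  toFun := MvPolynomial.pderiv j
  map_add' := map_add _
  map_smul' c p := map_zsmul _ c p
  map_one_eq_zero' := Derivation.map_one_eq_zero _
  leibniz' := Derivation.leibniz _

theorem polyDeriv_apply (j : Fin n ⊕ Fin r) (p : CoeffRing n r) :
    polyDeriv n r j p = MvPolynomial.pderiv j p := rfl

theorem gradSeries_revF : gradSeries (CoeffRing n r) (polyDeriv n r) (revF n r) =
    Sum.elim (fun i : Fin n => X ^ (n - i : ℕ)) fun _ => 0 := by
  funext j
  refine (gradSeries_revMonic (polyDeriv n r) n (aVar n r) j).trans ?_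
  rw [Finset.sum_range]
  obtain j | j := j
  · simp [polyDeriv_apply, aVar, MvPolynomial.pderiv_X, Pi.single_apply]
  · simp [polyDeriv_apply, aVar, MvPolynomial.pderiv_X]

theorem gradSeries_revG : gradSeries (CoeffRing n r) (polyDeriv n r) (revG n r) =
    Sum.elim (fun _ => 0) fun j : Fin r => X ^ (r - j : ℕ) := by
  funext j
  refine (gradSeries_revMonic (polyDeriv n r) r (bVar n r) j).trans ?_
  rw [Finset.sum_range]
  obtain j | j := j
  · simp [polyDeriv_apply, bVar, MvPolynomial.pderiv_X]
  · simp [polyDeriv_apply, bVar, MvPolynomial.pderiv_X, Pi.single_apply]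

variable {n r}

theorem derivB_coeff {j k L : ℕ} (hj : j < r) (hL : r - j ≤ L) :
    derivB n r j (coeff L (revF n r * revGInv n r ^ k)) =
      (-k : ℤ) • coeff (L - (r - j)) (revF n r * revGInv n r ^ (k + 1)) := by
  rw [derivB, dif_pos hj]
  rw [← polyDeriv_apply]
  have hF := congrFun (gradSeries_revF n r) (Sum.inr ⟨j, hj⟩)
  have hG := congrFun (gradSeries_revG n r) (Sum.inr ⟨j, hj⟩)
  exact derivation_coeff_mul_inv_pow (revG_mul_revGInv n r) hF hG k hL

theorem derivB_zsmul (j : ℕ) (c : ℤ) (p : CoeffRing n r) :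
    derivB n r j (c • p) = c • derivB n r j p := by
  rw [derivB, derivB]
  split_ifs
  · rw [map_zsmul]
  · rw [smul_zero]

theorem iterate_derivB_zero_coeff (hr : 0 < r) {k L p : ℕ} (hL : p * r ≤ L) :
    ∃ c : ℤ, c ≠ 0 ∧ (derivB n r 0)^[p] (coeff L (revF n r * revGInv n r ^ (k + 1))) =
      c • coeff (L - p * r) (revF n r * revGInv n r ^ (p + k + 1)) := by
  induction p with
  | zero => exact ⟨1, one_ne_zero, by simp⟩
  | succ p ih =>
    rw [Nat.succ_mul] at hL
    obtain ⟨c, hc, h⟩ := ih (by omega)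
    refine ⟨c * -(p + k + 1 : ℕ), mul_ne_zero hc (by omega), ?_⟩
    rw [Function.iterate_succ_apply', h, derivB_zsmul, derivB_coeff hr (by omega), smul_smul,
      Nat.sub_zero, Nat.sub_sub, Nat.succ_mul, add_right_comm p 1 k]

theorem isUnit_intCast_of_ringHom {A : Type*} [CommRing A] (φ : ℂ →+* A) {c : ℤ} (hc : c ≠ 0) :
    IsUnit (c : A) := by
  rw [← map_intCast φ]
  exact (isUnit_iff_ne_zero.mpr (Int.cast_ne_zero.mpr hc)).map φ

variable {q r₁ : ℕ}

theorem dPoly_eq_coeff {k : ℕ} (hk : k < n) :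
    dPoly n r k = coeff (n - k) (revF n r * revGInv n r) :=
  dTop_eq_coeff n r (by omega) (by omega)

theorem psiPoly_eq_iterate_derivB {s i : ℕ} (hs : s + 1 < q) (hi : i < r) :
    psiPoly n r q r₁ ((s + 1) * r + i) =
      (derivB n r 0)^[s] (derivB n r (r - 1 - i) (dPoly n r (r - 1))) := by
  have hlt : (s + 1) * r + i < q * r :=
    calc (s + 1) * r + i < (s + 1 + 1) * r := by rw [Nat.succ_mul (s + 1)]; omega
      _ ≤ q * r := Nat.mul_le_mul_right r hs
  have hdiv : ((s + 1) * r + i) / r = s + 1 := by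
    rw [mul_comm, Nat.mul_add_div (by omega), Nat.div_eq_of_lt hi, add_zero]
  have hmod : ((s + 1) * r + i) % r = i := by
    rw [mul_comm, Nat.mul_add_mod, Nat.mod_eq_of_lt hi]
  rw [psiPoly, if_neg (by rw [Nat.succ_mul]; omega), if_pos hlt, hdiv, hmod, Nat.add_sub_cancel]

theorem mul_add_le_of_lt {s : ℕ} (hn : q * r ≤ n) (hs : s < q) : s * r + r ≤ n :=
  (Nat.succ_mul s r).ge.trans ((Nat.mul_le_mul_right r hs).trans hn)

theorem associated_psiPoly {s i : ℕ} (hn : q * r ≤ n) (hs : s < q) (hi : i < r) :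
    Associated (psiPoly n r q r₁ (s * r + i))
      (coeff (n - s * r - i) (revF n r * revGInv n r ^ (s + 1))) := by
  have hsn := mul_add_le_of_lt hn hs
  obtain _ | s := s
  · rw [zero_mul, zero_add, zero_add, pow_one, Nat.sub_zero, psiPoly, if_pos hi,
      dPoly_eq_coeff (by omega)]
  rw [Nat.succ_mul] at hsn
  have derivB_dPoly : derivB n r (r - 1 - i) (dPoly n r (r - 1)) =
      (-1 : ℤ) • coeff (n - r - i) (revF n r * revGInv n r ^ (1 + 1)) := by
    have sub_eq : n - (r - 1) - (r - (r - 1 - i)) = n - r - i := by omega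
    rw [dPoly_eq_coeff (by omega), ← pow_one (revGInv n r), derivB_coeff (by omega) (by omega),
      sub_eq, pow_one, Nat.cast_one]
  obtain ⟨c, hc, iterate_coeff⟩ := iterate_derivB_zero_coeff (n := n) (by omega : 0 < r) (k := 1)
    (L := n - r - i) (p := s) (by omega)
  have iterate_zsmul (p : CoeffRing n r) :
      (derivB n r 0)^[s] ((-1 : ℤ) • p) = (-1 : ℤ) • (derivB n r 0)^[s] p :=
    Function.Commute.iterate_left (derivB_zsmul 0 (-1)) s p
  have sub_eq : n - r - i - s * r = n - (s + 1) * r - i := by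
    rw [Nat.succ_mul]
    omega
  rw [psiPoly_eq_iterate_derivB hs hi, derivB_dPoly, iterate_zsmul, iterate_coeff, smul_smul,
    zsmul_eq_mul, sub_eq]
  exact associated_unit_mul_left _ _
    (isUnit_intCast_of_ringHom MvPolynomial.C (mul_ne_zero (by decide) hc))

theorem psiPoly_eq_coeff {i : ℕ} (hn : n = q * r + r₁) (hq : 1 ≤ q) (hr₁ : r₁ ≤ r) (hi : i < r₁) :
    psiPoly n r q r₁ (q * r + i) =
      coeff (r - i) (revG n r * (revFInv n r * revG n r ^ q)) := by
  obtain ⟨q, rfl⟩ := Nat.exists_eq_add_of_le' hq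
  rw [Nat.succ_mul] at hn
  rw [psiPoly, Nat.succ_mul, if_neg (by omega), if_neg (by omega), Nat.add_sub_cancel,
    Nat.add_sub_cancel_left, betaPoly_eq_coeff n r _ (by omega) (by omega)]
  congr 2
  omega

end partialDerivatives

section germs
variable {σ : Type} [Fintype σ]

theorem HolGerm.exists_rep (φ : HolGerm σ) : ∃ (f : (σ → ℂ) → ℂ) (hf : AnalyticAt ℂ f 0),
    φ = ⟨(f : Germ (𝓝 (0 : σ → ℂ)) ℂ), f, hf, rfl⟩ := by
  obtain ⟨_, f, hf, rfl⟩ := φ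
  exact ⟨f, hf, rfl⟩

/-- `polyGerm` as a ring homomorphism. -/
def polyGermHom (σ : Type) [Fintype σ] : MvPolynomial σ ℂ →+* HolGerm σ where
  toFun := polyGerm
  map_one' := Subtype.ext (congrArg ((↑) : ((σ → ℂ) → ℂ) → Germ (𝓝 (0 : σ → ℂ)) ℂ)
    (funext fun x => map_one (MvPolynomial.eval x)))
  map_zero' := Subtype.ext (congrArg ((↑) : ((σ → ℂ) → ℂ) → Germ (𝓝 (0 : σ → ℂ)) ℂ)
    (funext fun x => map_zero (MvPolynomial.eval x)))
  map_add' p q := Subtype.ext (congrArg ((↑) : ((σ → ℂ) → ℂ) → Germ (𝓝 (0 : σ → ℂ)) ℂ)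
    (funext fun x => map_add (MvPolynomial.eval x) p q))
  map_mul' p q := Subtype.ext (congrArg ((↑) : ((σ → ℂ) → ℂ) → Germ (𝓝 (0 : σ → ℂ)) ℂ)
    (funext fun x => map_mul (MvPolynomial.eval x) p q))

/-- The value of a germ at the origin. -/
def HolGerm.valueHom (σ : Type) [Fintype σ] : HolGerm σ →+* ℂ :=
  Filter.Germ.valueRingHom.comp (HolGerm σ).subtype

theorem HolGerm.valueHom_polyGermHom (p : MvPolynomial σ ℂ) :
    HolGerm.valueHom σ (polyGermHom σ p) = MvPolynomial.eval 0 p := rfl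

theorem hasFDerivAt_eval_mvPolynomial (p : MvPolynomial σ ℂ) (x : σ → ℂ) :
    HasFDerivAt (fun y => MvPolynomial.eval y p)
      (∑ i, MvPolynomial.eval x (MvPolynomial.pderiv i p) •
        (ContinuousLinearMap.proj i : (σ → ℂ) →L[ℂ] ℂ)) x := by
  classical
  induction p using MvPolynomial.induction_on with
  | C a =>
    simp only [MvPolynomial.eval_C]
    exact (hasFDerivAt_const a x).congr_fderiv (by ext; simp)
  | add p q hp hq =>
    simp only [map_add]
    exact (hp.fun_add hq).congr_fderiv (by ext; simp [add_mul, Finset.sum_add_distrib])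
  | mul_X p i hp =>
    have hX : HasFDerivAt (fun y : σ → ℂ => y i) (ContinuousLinearMap.proj (R := ℂ) i) x :=
      hasFDerivAt_apply i x
    simp only [map_mul, MvPolynomial.eval_X]
    refine (hp.mul hX).congr_fderiv ?_
    ext y
    simp [MvPolynomial.pderiv_X, Pi.single_apply, Finset.sum_add_distrib, Finset.mul_sum, add_mul,
      mul_assoc, apply_ite]

variable [DecidableEq σ]

/-- `HolGerm.partialDeriv` as a derivation. -/
def HolGerm.deriv (j : σ) : IntDerivation (HolGerm σ) :=
  Derivation.mk'
    (AddMonoidHom.mk' (HolGerm.partialDeriv j) fun φ ψ => by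
      obtain ⟨f, hf, rfl⟩ := HolGerm.exists_rep φ
      obtain ⟨g, hg, rfl⟩ := HolGerm.exists_rep ψ
      refine Subtype.ext (Germ.coe_eq.mpr ?_)
      filter_upwards [hf.eventually_analyticAt, hg.eventually_analyticAt] with x hfx hgx
      exact congrArg (fun L => L (Pi.single j 1))
        (fderiv_add hfx.differentiableAt hgx.differentiableAt)).toIntLinearMap
    fun φ ψ => by
      obtain ⟨f, hf, rfl⟩ := HolGerm.exists_rep φ
      obtain ⟨g, hg, rfl⟩ := HolGerm.exists_rep ψ
      refine Subtype.ext (Germ.coe_eq.mpr ?_)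
      filter_upwards [hf.eventually_analyticAt, hg.eventually_analyticAt] with x hfx hgx
      exact congrArg (fun L => L (Pi.single j 1))
        (fderiv_mul hfx.differentiableAt hgx.differentiableAt)

theorem jacobianExt_eq_minorExt (k : ℕ) (J : Ideal (HolGerm σ)) :
    jacobianExt k J = minorExt HolGerm.deriv k J := rfl

theorem upperJacobianExt_eq_minorExt {i k : ℕ} (hik : Fintype.card σ = k + i)
    (J : Ideal (HolGerm σ)) :
    upperJacobianExt i J = minorExt HolGerm.deriv (k + 1) J := by
  rw [upperJacobianExt, jacobianExt_eq_minorExt, hik, add_right_comm, Nat.add_sub_cancel]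

theorem isCriticalUpper_iff {i k : ℕ} (hik : Fintype.card σ = k + i) {J : Ideal (HolGerm σ)} :
    IsCriticalUpper i J ↔
      minorExt HolGerm.deriv (k + 1) J ≠ ⊤ ∧ minorExt HolGerm.deriv k J = ⊤ := by
  rw [IsCriticalUpper, jacobianExt_eq_minorExt, jacobianExt_eq_minorExt, hik, add_right_comm,
    Nat.add_sub_cancel, Nat.add_sub_cancel, and_iff_right (Nat.le_add_left i k)]

theorem HolGerm.deriv_polyGermHom (j : σ) (p : MvPolynomial σ ℂ) :
    HolGerm.deriv j (polyGermHom σ p) = polyGermHom σ (MvPolynomial.pderiv j p) := by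
  refine Subtype.ext (Germ.coe_eq.mpr (Eventually.of_forall fun x => ?_))
  have := congrArg (fun L => L (Pi.single j 1)) (hasFDerivAt_eval_mvPolynomial p x).fderiv
  refine this.trans ?_
  simp [Pi.single_apply]

end germs

section multiplication
variable {n r q r₁ s : ℕ} {A : Type*} [CommRing A] {φ : CoeffRing n r →+* A}
  {δ : Fin n ⊕ Fin r → IntDerivation A}

theorem vcoeff_gradSeries_map_revF (hδ : ∀ j p, δ j (φ p) = φ (polyDeriv n r j p)) (i : Fin n) :
    vcoeff (n - i) (gradSeries A δ (map φ (revF n r))) = Pi.single (Sum.inl i) 1 := by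
  ext j
  rw [vcoeff_apply, gradSeries_map hδ, congrFun (gradSeries_revF n r) j]
  rcases j with j | j
  · simp only [Sum.elim_inl, map_pow, map_X, coeff_X_pow, Pi.single_apply, Sum.inl.injEq]
    exact if_congr (by omega) rfl rfl
  · simp

theorem vcoeff_gradSeries_map_revG (hδ : ∀ j p, δ j (φ p) = φ (polyDeriv n r j p)) (i : Fin r) :
    vcoeff (r - i) (gradSeries A δ (map φ (revG n r))) = Pi.single (Sum.inr i) 1 := by
  ext j
  rw [vcoeff_apply, gradSeries_map hδ, congrFun (gradSeries_revG n r) j]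
  rcases j with j | j
  · simp
  · simp only [Sum.elim_inr, map_pow, map_X, coeff_X_pow, Pi.single_apply, Sum.inr.injEq]
    exact if_congr (by omega) rfl rfl

theorem genericPair_revF_revG (hδ : ∀ j p, δ j (φ p) = φ (polyDeriv n r j p)) (x : ℕ → A) :
    GenericPair δ x 0 n r (map φ (revF n r)) (map φ (revG n r)) where
  card := by simp
  constantCoeff_left := by simp [revF, map_revMonic, constantCoeff_revMonic]
  constantCoeff_right := by simp [revG, map_revMonic, constantCoeff_revMonic]
  tail_left l hl := by
    rw [revF, map_revMonic, coeff_revMonic (by omega), if_neg (by omega)]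
    exact zero_mem _
  tail_right l hl := by
    rw [revG, map_revMonic, coeff_revMonic (by omega), if_neg (by omega)]
    exact zero_mem _
  eq_top Ω hF hG := by
    classical
    rw [eq_top_iff, ← (Pi.basisFun A (Fin n ⊕ Fin r)).span_eq, Submodule.span_le]
    rintro _ ⟨i | i, rfl⟩
    · simpa [vcoeff_gradSeries_map_revF hδ] using hF (n - i)
    · simpa [vcoeff_gradSeries_map_revG hδ] using hG (r - i)

theorem map_revG_mul_map_revGInv : map φ (revG n r) * map φ (revGInv n r) = 1 := by
  rw [← map_mul, revG_mul_revGInv, map_one]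

theorem associated_map_psiPoly (φ : CoeffRing n r →+* A) (hn : q * r ≤ n) (hs : s < q) {i : ℕ}
    (hi : i < r) : Associated (φ (psiPoly n r q r₁ (s * r + i)))
      (coeff (n - s * r - i)
        (map φ (revF n r * revGInv n r ^ s) * map φ (revGInv n r))) := by
  rw [← map_mul, coeff_map, mul_assoc, ← pow_succ]
  exact (associated_psiPoly hn hs hi).map φ

theorem genericPair_div_pow (hδ : ∀ j p, δ j (φ p) = φ (polyDeriv n r j p)) (hn : q * r ≤ n)
    (hs : s ≤ q) : GenericPair δ (fun k => φ (psiPoly n r q r₁ k)) (s * r) (n - s * r) r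
      (map φ (revF n r * revGInv n r ^ s)) (map φ (revG n r)) := by
  induction s with
  | zero => simpa using genericPair_revF_revG hδ _
  | succ s ih =>
    have le_sub : r ≤ n - s * r := Nat.le_sub_of_add_le' (mul_add_le_of_lt hn hs)
    have := (ih (by omega)).div map_revG_mul_map_revGInv le_sub fun _ =>
      associated_map_psiPoly φ hn hs
    rwa [← map_mul, mul_assoc, ← pow_succ, ← Nat.succ_mul, Nat.sub_sub, ← Nat.succ_mul] at this

theorem isUnit_natCast_succ_of_ringHom (φ : CoeffRing n r →+* A) (a : ℕ) :
    IsUnit ((a + 1 : ℕ) : A) := by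
  simpa using
    isUnit_intCast_of_ringHom (φ.comp MvPolynomial.C) (Nat.cast_ne_zero.mpr a.succ_ne_zero)

/-- The ideal generated by `ψ_0, …, ψ_{k-1}` and the coefficients of the product of the two
generic polynomials, extended along `φ`. -/
def psiIdeal (φ : CoeffRing n r →+* A) (q r₁ k : ℕ) : Ideal A :=
  stepIdeal (fun k => φ (psiPoly n r q r₁ k)) k (map φ (revF n r * revG n r))

theorem pow_mul_div_pow {R : Type*} [CommRing R] {f g gi : R} (hg : g * gi = 1) (s : ℕ) :
    g ^ s * (f * gi ^ s) = f := by
  rw [mul_left_comm, ← mul_pow, hg, one_pow, mul_one]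

theorem minorExt_psiIdeal (hδ : ∀ j p, δ j (φ p) = φ (polyDeriv n r j p)) (hn : q * r ≤ n)
    (hs : s < q) :
    minorExt δ n (psiIdeal φ q r₁ (s * r)) = ⊤ ∧
      minorExt δ (n + 1) (psiIdeal φ q r₁ (s * r)) = psiIdeal φ q r₁ ((s + 1) * r) := by
  have hsr := mul_add_le_of_lt hn hs
  have pair := genericPair_div_pow (r₁ := r₁) hδ hn hs.le
  have isUnit := isUnit_natCast_succ_of_ringHom φ
  have hK : map φ (revF n r * revGInv n r ^ s) ^ (0 + 1) * map φ (revG n r) ^ (s + 1) =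
      map φ (revF n r * revG n r) := by
    rw [← map_pow, ← map_pow, ← map_mul, zero_add, pow_one, pow_succ, ← mul_assoc,
      mul_comm _ (revG n r ^ s), pow_mul_div_pow (revG_mul_revGInv n r)]
  have add_sub : s * r + (n - s * r) = n := by omega
  have eq_top := pair.minorExt_stepIdeal_eq_top map_revG_mul_map_revGInv (isUnit 0) (isUnit s) hK
  have eq_succ := pair.minorExt_stepIdeal_succ map_revG_mul_map_revGInv (isUnit 0) (isUnit s) hK
    (by omega) fun _ => associated_map_psiPoly φ hn hs
  rw [add_sub] at eq_top eq_succ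
  rw [Nat.succ_mul]
  exact ⟨eq_top, eq_succ⟩

theorem minorExt_psiIdeal_last (hδ : ∀ j p, δ j (φ p) = φ (polyDeriv n r j p))
    (hn : n = q * r + r₁) (hq : 1 ≤ q) (hr₁ : r₁ ≤ r) :
    minorExt δ (q * r + r) (psiIdeal φ q r₁ (q * r)) = ⊤ ∧
      minorExt δ (q * r + r + 1) (psiIdeal φ q r₁ (q * r)) = psiIdeal φ q r₁ (q * r + r₁) := by
  have pair := (genericPair_div_pow (r₁ := r₁) hδ (hn.ge.trans' (Nat.le_add_right _ _)) le_rfl).symm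
  have isUnit := isUnit_natCast_succ_of_ringHom φ
  have hHi : map φ (revF n r * revGInv n r ^ q) * map φ (revFInv n r * revG n r ^ q) = 1 := by
    rw [← map_mul, mul_comm (revFInv n r), ← mul_assoc, mul_comm _ (revG n r ^ q),
      pow_mul_div_pow (revG_mul_revGInv n r), revF_mul_revFInv, map_one]
  have hK : map φ (revG n r) ^ (q + 1) * map φ (revF n r * revGInv n r ^ q) ^ (0 + 1) =
      map φ (revF n r * revG n r) := by
    rw [← map_pow, ← map_pow, ← map_mul, zero_add, pow_one, pow_succ', mul_assoc,
      pow_mul_div_pow (revG_mul_revGInv n r), mul_comm]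
  have hx (i : ℕ) (hi : i < r₁) : Associated (φ (psiPoly n r q r₁ (q * r + i)))
      (coeff (r - i) (map φ (revG n r) * map φ (revFInv n r * revG n r ^ q))) := by
    rw [← map_mul, coeff_map, psiPoly_eq_coeff hn hq hr₁ hi]
  have sub_eq : n - q * r = r₁ := by omega
  rw [sub_eq] at pair
  exact ⟨pair.minorExt_stepIdeal_eq_top hHi (isUnit q) (isUnit 0) hK,
    pair.minorExt_stepIdeal_succ hHi (isUnit q) (isUnit 0) hK hr₁ hx⟩

theorem map_eval_zero_revF : map (MvPolynomial.eval 0) (revF n r) = 1 := by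
  have eval_aVar : MvPolynomial.eval 0 ∘ aVar n r = 0 := by
    ext i
    by_cases h : i < n <;> simp [aVar, h]
  rw [revF, map_revMonic, eval_aVar]
  simp [revMonic]

theorem map_eval_zero_revG : map (MvPolynomial.eval 0) (revG n r) = 1 := by
  have eval_bVar : MvPolynomial.eval 0 ∘ bVar n r = 0 := by
    ext j
    by_cases h : j < r <;> simp [bVar, h]
  rw [revG, map_revMonic, eval_bVar]
  simp [revMonic]

theorem map_eval_zero_revFInv : map (MvPolynomial.eval 0) (revFInv n r) = 1 := by
  have h := congrArg (PowerSeries.map (MvPolynomial.eval 0)) (revF_mul_revFInv n r)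
  rwa [map_mul, map_eval_zero_revF, one_mul, map_one] at h

theorem map_eval_zero_revGInv : map (MvPolynomial.eval 0) (revGInv n r) = 1 := by
  have h := congrArg (PowerSeries.map (MvPolynomial.eval 0)) (revG_mul_revGInv n r)
  rwa [map_mul, map_eval_zero_revG, one_mul, map_one] at h

theorem eval_zero_psiPoly {k : ℕ} (hn : n = q * r + r₁) (hq : 1 ≤ q) (hr₁ : r₁ ≤ r)
    (hk : k < q * r + r₁) : MvPolynomial.eval 0 (psiPoly n r q r₁ k) = 0 := by
  rcases lt_or_ge k (q * r) with hkq | hkq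
  · have hr : 0 < r := Nat.pos_of_ne_zero fun h => by simp [h] at hkq
    have h := associated_psiPoly (r₁ := r₁) (hn.ge.trans' (Nat.le_add_right _ _))
      ((Nat.div_lt_iff_lt_mul hr).mpr hkq) (Nat.mod_lt k hr)
    rw [Nat.div_add_mod', Nat.sub_sub, Nat.div_add_mod'] at h
    have := h.map (MvPolynomial.eval 0)
    rw [← coeff_map, map_mul, map_pow, map_eval_zero_revF, map_eval_zero_revGInv, one_pow,
      one_mul, coeff_one, if_neg (by omega)] at this
    exact this.eq_zero_iff.mpr rfl
  · obtain ⟨i, rfl⟩ := Nat.exists_eq_add_of_le hkq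
    have hi : i < r₁ := by omega
    rw [psiPoly_eq_coeff hn hq hr₁ hi, ← coeff_map, map_mul (PowerSeries.map _),
      map_mul (PowerSeries.map _), map_pow,
      map_eval_zero_revG, map_eval_zero_revFInv, one_pow, one_mul, one_mul, coeff_one,
      if_neg (by omega)]

theorem psiIdeal_ne_top {k : ℕ} (ε : A →+* ℂ) (hε : ∀ p, ε (φ p) = MvPolynomial.eval 0 p)
    (hn : n = q * r + r₁) (hq : 1 ≤ q) (hr₁ : r₁ ≤ r) (hk : k ≤ q * r + r₁) :
    psiIdeal φ q r₁ k ≠ ⊤ := by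
  have le_ker : psiIdeal φ q r₁ k ≤ RingHom.ker ε := by
    refine Ideal.span_le.mpr (Set.union_subset ?_ ?_)
    · rintro _ ⟨i, hi, rfl⟩
      exact (hε _).trans (eval_zero_psiPoly hn hq hr₁ (hi.trans_le hk))
    · rintro _ ⟨l, rfl⟩
      change ε (coeff (l + 1) (map φ _)) = 0
      rw [coeff_map, hε, ← coeff_map, map_mul,
        map_eval_zero_revF, map_eval_zero_revG, one_mul, coeff_one, if_neg l.succ_ne_zero]
  exact ne_top_of_le_ne_top (RingHom.ker_ne_top ε) le_ker

end multiplication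

section criticalExtensions
variable {n r q r₁ : ℕ}

theorem span_range_coeff_eq_muIdeal : Ideal.span (Set.range fun l => coeff (l + 1)
    (map (polyGermHom (Fin n ⊕ Fin r)) (revF n r * revG n r))) = muIdeal n r := by
  simp only [coeff_map, coeff_revF_mul_revG]
  refine le_antisymm (Ideal.span_le.mpr ?_) (Ideal.span_le.mpr ?_)
  · rintro _ ⟨l, rfl⟩
    rcases le_or_gt (l + 1) (n + r) with hl | hl
    · exact Ideal.subset_span ⟨n + r - (l + 1), by omega, by rw [← Polynomial.revAt_le hl]; rfl⟩
    · simp only [Polynomial.revAt_eq_self_of_lt hl, cPoly_eq_zero n r hl, map_zero]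
      exact zero_mem _
  · rintro _ ⟨j, hj, rfl⟩
    refine Ideal.subset_span ⟨n + r - j - 1, ?_⟩
    have index_eq : Polynomial.revAt (n + r) (n + r - j - 1 + 1) = j := by
      rw [Nat.sub_add_cancel (by omega), Polynomial.revAt_le (Nat.sub_le _ _),
        Nat.sub_sub_self hj.le]
    exact congrArg (fun i => polyGerm (cPoly n r i)) index_eq

theorem psiIdeal_polyGermHom (k : ℕ) : psiIdeal (polyGermHom (Fin n ⊕ Fin r)) q r₁ k =
    muIdeal n r ⊔ Ideal.span {φ | ∃ i, i < k ∧ φ = polyGerm (psiPoly n r q r₁ i)} := by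
  rw [psiIdeal, stepIdeal, Ideal.span_union, span_range_coeff_eq_muIdeal, sup_comm]
  congr 2
  ext
  simp [polyGermHom, eq_comm]

theorem iterate_upperJacobianExt_muIdeal (hn : q * r ≤ n) {s : ℕ} (hs : s ≤ q) :
    (upperJacobianExt r)^[s] (muIdeal n r) =
      psiIdeal (polyGermHom (Fin n ⊕ Fin r)) q r₁ (s * r) := by
  induction s with
  | zero => simp [psiIdeal_polyGermHom]
  | succ s ih =>
    have card_eq : Fintype.card (Fin n ⊕ Fin r) = n + r := by simp
    rw [Function.iterate_succ_apply', ih (by omega), upperJacobianExt_eq_minorExt card_eq]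
    exact (minorExt_psiIdeal HolGerm.deriv_polyGermHom hn hs).2

end criticalExtensions

theorem theorem3p10_general (n r q₁ r₁ : ℕ) (hq : 1 ≤ q₁) (hn : n = q₁ * r + r₁) (hr : r₁ ≤ r) :
    (∀ s < q₁, IsCriticalUpper r ((upperJacobianExt r)^[s] (muIdeal n r))) ∧
    IsCriticalUpper r₁ ((upperJacobianExt r)^[q₁] (muIdeal n r)) ∧
    (matBD n r q₁)⁻¹ = lowerToeplitz n n (betaPoly n r q₁) ∧
    upperJacobianExt r₁ ((upperJacobianExt r)^[q₁] (muIdeal n r)) =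
      muIdeal n r ⊔
        Ideal.span {φ | ∃ k, k < q₁ * r + r₁ ∧ φ = polyGerm (psiPoly n r q₁ r₁ k)} := by
  have hqr : q₁ * r ≤ n := by omega
  have iterate_eq {s : ℕ} (hs : s ≤ q₁) :=
    iterate_upperJacobianExt_muIdeal (r₁ := r₁) hqr hs
  have ne_top {k : ℕ} (hk : k ≤ q₁ * r + r₁) :=
    psiIdeal_ne_top (HolGerm.valueHom (Fin n ⊕ Fin r)) HolGerm.valueHom_polyGermHom hn hq hr hk
  have card_eq : Fintype.card (Fin n ⊕ Fin r) = n + r := by simp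
  have card_eq_last : Fintype.card (Fin n ⊕ Fin r) = q₁ * r + r + r₁ := by omega
  obtain ⟨last_eq_top, last_eq⟩ := minorExt_psiIdeal_last HolGerm.deriv_polyGermHom hn hq hr
  refine ⟨fun s hs => ?_, ?_, inv_matBD_eq_lowerToeplitz n r q₁, ?_⟩
  · obtain ⟨eq_top, eq_succ⟩ := minorExt_psiIdeal HolGerm.deriv_polyGermHom hqr hs (r₁ := r₁)
    rw [iterate_eq hs.le, isCriticalUpper_iff card_eq, eq_succ]
    exact ⟨ne_top ((Nat.mul_le_mul_right r hs).trans (Nat.le_add_right _ _)), eq_top⟩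
  · rw [iterate_eq le_rfl, isCriticalUpper_iff card_eq_last, last_eq]
    exact ⟨ne_top le_rfl, last_eq_top⟩
  · rw [iterate_eq le_rfl, upperJacobianExt_eq_minorExt card_eq_last, last_eq, psiIdeal_polyGermHom]

end

theorem theorem3p10 (n r q₁ r₁ : ℕ) (hq : 1 ≤ q₁) (hn : n = q₁ * r + r₁)
    (hr₁ : 0 < r₁) (hr : r₁ < r) :
    -- the successive critical extensions of `I(μ_{n,r})` are `Δ^r` (`q₁` times), then `Δ^{r₁}`
    (∀ s < q₁, IsCriticalUpper r ((upperJacobianExt r)^[s] (muIdeal n r))) ∧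
    IsCriticalUpper r₁ ((upperJacobianExt r)^[q₁] (muIdeal n r)) ∧
    -- `(B^{-q₁} D̂)⁻¹ = I_n + β_{n-1} L_n + ⋯ + β_1 L_n^{n-1}`
    (matBD n r q₁)⁻¹ = lowerToeplitz n n (betaPoly n r q₁) ∧
    -- the `(q₁+1)`-th critical extension
    upperJacobianExt r₁ ((upperJacobianExt r)^[q₁] (muIdeal n r)) =
      muIdeal n r ⊔
        Ideal.span {φ | ∃ k, k < q₁ * r + r₁ ∧ φ = polyGerm (psiPoly n r q₁ r₁ k)} :=
  theorem3p10_general n r q₁ r₁ hq hn hr.le
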